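/- **Bilinear Strichartz estimate.** Let $d \ge 2$ and $0 < \delta < d/2$. There is a constant $C = C(d,\delta)$ such that for every interval $I \subset \mathbb{R}$ (compact or not), every $t_0 \in I$, and all $u, v$ on the spacetime slab $I \times \mathbb{R}^d$, $$\| u v \|_{L^2_{t,x}(I \times \mathbb{R}^d)} \le C \Big( \|u(t_0)\|_{\dot H^{-1/2+\delta}(\mathbb{R}^d)} + \|(i\partial_t + \Delta) u\|_{L^1_t \dot H^{-1/2+\delta}_x(I \times \mathbb{R}^d)} \Big) \Big( \|v(t_0)\|_{\dot H^{\frac{d-1}{2}-\delta}(\mathbb{R}^d)} + \|(i\partial_t + \Delta) v\|_{L^1_t \dot H^{\frac{d-1}{2}-\delta}_x(I \times \mathbb{R}^d)} \Big).$$ Here $u$ and $v$ are continuous maps from $I$ to the tempered distributions on $\mathbb{R}^d$ (with the topology of pointwise convergence on Schwartz functions); for almost every $t\in I$, $u(t)$ and $v(t)$ are locally integrable functions of $x$, jointly measurable in $(t,x)$; and $(i\partial_t+\Delta)u$, $(i\partial_t+\Delta)v$ (understood weakly) are time-dependent tempered distributions whose pairings with each Schwartz function are locally integrable in time on $I$.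 In particular, $u$ and $v$ may be any functions that are smooth in time with values in the Schwartz functions of $x$. The norms are $\|f\|_{\dot H^s} = \|\,|\xi|^s \hat f\,\|_{L^2}$ (equal to $+\infty$ if $\hat f$ is not a locally integrable function) and $\|F\|_{L^1_t\dot H^s_x} = \int_I \|F(t)\|_{\dot H^s}\,dt$; both sides of the inequality are in $[0,\infty]$, with $0\cdot\infty=0$. -/

import Mathlib

open MeasureTheory
open scoped SchwartzMap FourierTransform Laplacian ENNReal NNReal

noncomputable section

/-- The tempered distribution `f` on `ℝ^d` is (given by) the locally integrable function `g`:
`f(φ) = ∫ g φ` for all compactly supported Schwartz functions `φ`. Such a `g` is unique up to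
null sets, and `f` is determined by `g` because these `φ` are dense in the Schwartz space. -/
def IsGivenBy {d : ℕ} (f : 𝓢'(EuclideanSpace ℝ (Fin d), ℂ))
    (g : EuclideanSpace ℝ (Fin d) → ℂ) : Prop :=
  LocallyIntegrable g volume ∧
    ∀ φ : 𝓢(EuclideanSpace ℝ (Fin d), ℂ), HasCompactSupport φ → f φ = ∫ x, g x * φ x

/-- The homogeneous Sobolev norm `‖f‖_{Ḣ^s} = ‖ |ξ|^s f̂ ‖_{L²}` of a tempered distribution whose
Fourier transform is a locally integrable function. It is `∞` if `f̂` is not such a function (the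
infimum is then over the empty set; otherwise all admissible `g` agree almost everywhere). -/
def homSobolevNorm {d : ℕ} (s : ℝ) (f : 𝓢'(EuclideanSpace ℝ (Fin d), ℂ)) : ℝ≥0∞ :=
  ⨅ (g : EuclideanSpace ℝ (Fin d) → ℂ) (_ : IsGivenBy (𝓕 f) g),
    eLpNorm (fun ξ => ((‖ξ‖ ^ s : ℝ) : ℂ) * g ξ) 2 volume

/-- The norm `‖F‖_{L¹_t Ḣ^s_x(I × ℝ^d)} = ∫_I ‖F(t)‖_{Ḣ^s} dt` of a time-dependent tempered
distribution. Here `G t` is the spatial Fourier transform of `F t` for almost every `t ∈ I`, chosen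
jointly measurable in `(t, ξ)`; the norm is `∞` if there is no such `G`, and otherwise the integral
does not depend on the choice of `G`. -/
def timeL1HomSobolevNorm {d : ℕ} (I : Set ℝ) (s : ℝ)
    (F : ℝ → 𝓢'(EuclideanSpace ℝ (Fin d), ℂ)) : ℝ≥0∞ :=
  ⨅ (G : ℝ → EuclideanSpace ℝ (Fin d) → ℂ)
    (_ : AEStronglyMeasurable (Function.uncurry G) ((volume.restrict I).prod volume))
    (_ : ∀ᵐ t ∂(volume.restrict I), IsGivenBy (𝓕 (F t)) (G t)),
    ∫⁻ t in I, eLpNorm (fun ξ => ((‖ξ‖ ^ s : ℝ) : ℂ) * G t ξ) 2 volume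

/-- `(i∂_t + Δ)u = F` on `I × ℝ^d`, in the weak sense: `u` is continuous on `I` with values in the
tempered distributions (for the topology of pointwise convergence on Schwartz functions), `F` is
weakly locally integrable in time, and for every Schwartz function `φ`, the equation
`∂_t u(φ) = i (Δu)(φ) - i F(φ)` holds in its time-integrated form between any two times of `I`. -/
structure IsForcedSchrodinger {d : ℕ} (I : Set ℝ)
    (u F : ℝ → 𝓢'(EuclideanSpace ℝ (Fin d), ℂ)) : Prop where
  continuousOn : ∀ φ : 𝓢(EuclideanSpace ℝ (Fin d), ℂ), ContinuousOn (fun t => u t φ) I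
  locallyIntegrableOn : ∀ φ : 𝓢(EuclideanSpace ℝ (Fin d), ℂ),
    LocallyIntegrableOn (fun t => F t φ) I volume
  equation : ∀ φ : 𝓢(EuclideanSpace ℝ (Fin d), ℂ), ∀ a ∈ I, ∀ b ∈ I,
    u b φ - u a φ = ∫ t in a..b, (Complex.I * (Δ (u t)) φ - Complex.I * F t φ)

/-- The time-dependent tempered distribution `u` on the slab `I × ℝ^d` is given by the measurable
function `U`: for almost every `t ∈ I`, `u t` is the function `U t`. -/
def IsGivenByOnSlab {d : ℕ} (I : Set ℝ) (u : ℝ → 𝓢'(EuclideanSpace ℝ (Fin d), ℂ))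
    (U : ℝ → EuclideanSpace ℝ (Fin d) → ℂ) : Prop :=
  AEStronglyMeasurable (Function.uncurry U) ((volume.restrict I).prod volume) ∧
    ∀ᵐ t ∂(volume.restrict I), IsGivenBy (u t) (U t)

end

/-! By Duhamel's formula each solution is a superposition of free waves: one carries the datum at
`t₀`, and one starts at each time `r` with datum the forcing at `r`. Minkowski's inequality over
pairs of such waves reduces the theorem to a product of two free waves with frequency profiles `h`
and `k`.

For free waves one argues by duality (`exists_eLpNorm_freeWave_mul_le`). Pairing the product with a
test function `χ` on spacetime gives `∫∫ h(ξ) k(η) χ̂(2π(|ξ|² + |η|²), -(ξ + η))`. Cauchy–Schwarz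
extracts the weighted norms of `h` and `k` and leaves `∫∫ |ξ|^(-α) |η|^(-β) |χ̂|²` with `α = 2s`, `β
= 2s'`. For a fixed sum of frequencies, centring at the midpoint and using polar coordinates turns
the modulation into the radial variable, and everything rests on a uniform bound for `r^(d-2) ∫ |rθ
- a|^(-α) |rθ + a|^(-β) dθ` (`exists_lintegral_toSphere_weight_le`). The scaling is right because `α
+ β = d - 2`, and the singularities on the sphere are integrable because `α, β < d - 1`; these last
conditions are exactly `δ < d/2` and `δ > 0`.

Since the solutions are only distribution-valued, Duhamel's formula is proved on moments
(`IsForcedSchrodinger.enorm_fourier_apply_le_of_hasCompactSupport`). The pairings of `û(t)` with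
`|ξ|^(2n) ψ` satisfy a linear hierarchy of ODEs whose iteration produces the Taylor series of the
propagator; uniform boundedness controls the remainder. Mollification in `x` makes the profiles
integrable, and Fatou's lemma removes it at the end. -/

/-! ### Spherical caps and singular integrals on the sphere. -/

open Metric Set Pointwise in
/-- A spherical cap of radius `ε` has surface measure at most a constant times `ε ^ (d - 1)`. -/
theorem toSphere_cap_le {d : ℕ} (hd : 1 ≤ d) (e : EuclideanSpace ℝ (Fin d)) (he : ‖e‖ = 1)
    {ε : ℝ} (hε : 0 < ε) (hε' : ε ≤ 4) :
    (volume : Measure (EuclideanSpace ℝ (Fin d))).toSphere {θ | ‖e - (θ : EuclideanSpace ℝ (Fin d))‖ < ε} ≤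
      ENNReal.ofReal (d * 9 * 2 ^ d * ε ^ (d - 1 : ℕ)) *
        volume (ball (0 : EuclideanSpace ℝ (Fin d)) 1) := by
  have hmeas : MeasurableSet {θ : sphere (0 : EuclideanSpace ℝ (Fin d)) 1 |
      ‖e - (θ : EuclideanSpace ℝ (Fin d))‖ < ε} :=
    (isOpen_lt (by fun_prop) (by fun_prop)).measurableSet
  rw [Measure.toSphere_apply' _ hmeas, finrank_euclideanSpace_fin]
  -- The measure of the cap is `d` times the volume of the cone over it. That cone is covered by
  -- about `1/ε` balls of radius `2ε` strung along the segment from `0` to `e`, each of volume of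
  -- order `ε ^ d`.
  set N : ℕ := ⌈1 / ε⌉₊ + 1 with hN
  have hcover : Ioo (0 : ℝ) 1 • ((↑) '' {θ : sphere (0 : EuclideanSpace ℝ (Fin d)) 1 |
      ‖e - (θ : EuclideanSpace ℝ (Fin d))‖ < ε}) ⊆
      ⋃ j ∈ Finset.range N, ball ((j * ε) • e) (2 * ε) := by
    rintro _ ⟨r, hr, _, ⟨θ, hθ, rfl⟩, rfl⟩
    simp only [mem_ofPred_eq] at hθ
    simp only [mem_iUnion, Finset.mem_range, exists_prop]
    have hj : (⌊r / ε⌋₊ : ℝ) ≤ r / ε := Nat.floor_le (div_nonneg hr.1.le hε.le)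
    have hj' : r / ε < ⌊r / ε⌋₊ + 1 := Nat.lt_floor_add_one _
    refine ⟨⌊r / ε⌋₊, ?_, ?_⟩
    · have : ⌊r / ε⌋₊ ≤ ⌈1 / ε⌉₊ := by
        apply (Nat.floor_le_ceil _).trans
        apply Nat.ceil_mono
        gcongr
        exact hr.2.le
      omega
    · rw [mem_ball, dist_eq_norm]
      have h1 : r • (θ : EuclideanSpace ℝ (Fin d)) - ((⌊r / ε⌋₊ : ℝ) * ε) • e =
          r • ((θ : EuclideanSpace ℝ (Fin d)) - e) + (r - ⌊r / ε⌋₊ * ε) • e := by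
        module
      change ‖r • (θ : EuclideanSpace ℝ (Fin d)) - ((⌊r / ε⌋₊ : ℝ) * ε) • e‖ < 2 * ε
      rw [h1]
      refine (norm_add_le _ _).trans_lt ?_
      rw [norm_smul, norm_smul, he, mul_one, norm_sub_rev, Real.norm_of_nonneg hr.1.le]
      rw [le_div_iff₀ hε] at hj
      rw [div_lt_iff₀ hε] at hj'
      rw [Real.norm_of_nonneg (by linarith)]
      have := mul_le_mul_of_nonneg_right hr.2.le (norm_nonneg (e - (θ : EuclideanSpace ℝ (Fin d))))
      linarith
  have hNle : (N : ℝ) ≤ 9 / ε := by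
    have := Nat.ceil_lt_add_one (a := 1 / ε) (by positivity)
    rw [hN]; push_cast
    have h4 : 1 ≤ 4 / ε := by rw [le_div_iff₀ hε]; linarith
    have : 9 / ε = 1 / ε + (4 / ε + 4 / ε) := by ring
    linarith
  calc (d : ℝ≥0∞) * volume (Ioo (0 : ℝ) 1 • (Subtype.val '' {θ : sphere (0 : EuclideanSpace ℝ (Fin d)) 1 |
      ‖e - (θ : EuclideanSpace ℝ (Fin d))‖ < ε}))
      ≤ d * ∑ j ∈ Finset.range N, volume (ball (((j : ℝ) * ε) • e) (2 * ε)) := by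
        gcongr
        exact (measure_mono hcover).trans (measure_biUnion_finset_le _ _)
    _ = d * (N * (ENNReal.ofReal ((2 * ε) ^ d) *
          volume (ball (0 : EuclideanSpace ℝ (Fin d)) 1))) := by
        congr 1
        rw [Finset.sum_congr rfl fun j _ => Measure.addHaar_ball_of_pos volume _ (by positivity)]
        simp
    _ = ENNReal.ofReal (d * N * (2 * ε) ^ d) *
          volume (ball (0 : EuclideanSpace ℝ (Fin d)) 1) := by
        rw [ENNReal.ofReal_mul (by positivity), ENNReal.ofReal_mul (by positivity)]
        simp [mul_assoc]
    _ ≤ _ := by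
        refine mul_le_mul_left (ENNReal.ofReal_le_ofReal ?_) _
        obtain ⟨k, rfl⟩ : ∃ k, d = k + 1 := ⟨d - 1, by omega⟩
        rw [Nat.add_sub_cancel, mul_pow, pow_succ ε]
        calc ((k + 1 : ℕ) : ℝ) * N * (2 ^ (k + 1) * (ε ^ k * ε))
            ≤ ((k + 1 : ℕ) : ℝ) * (9 / ε) * (2 ^ (k + 1) * (ε ^ k * ε)) := by gcongr
          _ = _ := by field_simp

open Metric Set in
/-- Negative powers of order less than `d - 1` of the distance to a point of the unit sphere of
`ℝ^d` are integrable on the sphere, uniformly in the point. -/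
theorem exists_lintegral_toSphere_rpow_le {d : ℕ} (hd : 1 ≤ d) {γ : ℝ} (hγ : 0 ≤ γ)
    (hγd : γ < d - 1) :
    ∃ C : ℝ≥0, ∀ e : EuclideanSpace ℝ (Fin d), ‖e‖ = 1 →
      ∫⁻ θ, ENNReal.ofReal (‖e - (θ : EuclideanSpace ℝ (Fin d))‖ ^ (-γ))
        ∂(volume : Measure (EuclideanSpace ℝ (Fin d))).toSphere ≤ C := by
  set B := volume (ball (0 : EuclideanSpace ℝ (Fin d)) 1) with hB
  have hBtop : B ≠ ⊤ := measure_ball_lt_top.ne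
  -- Ratio of consecutive dyadic terms: the weight grows by `2 ^ γ` while the bound on the cap
  -- shrinks by `2 ^ (d - 1)`.
  set q : ℝ := 2 ^ (γ - (d - 1 : ℝ)) with hq
  have hq0 : 0 < q := by positivity
  have hq1 : q < 1 := Real.rpow_lt_one_of_one_lt_of_neg (by norm_num) (by linarith)
  set c : ℝ := d * 9 * 2 ^ d * 4 ^ (d - 1 : ℕ) with hc
  have hsum : (∑' j : ℕ, ENNReal.ofReal (c * q ^ j) * B) ≠ ⊤ := by
    rw [ENNReal.tsum_mul_right, ← ENNReal.ofReal_tsum_of_nonneg (fun j => by positivity)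
      ((summable_geometric_of_lt_one hq0.le hq1).mul_left c)]
    exact ENNReal.mul_ne_top ENNReal.ofReal_ne_top hBtop
  refine ⟨(∑' j : ℕ, ENNReal.ofReal (c * q ^ j) * B).toNNReal, fun e he => ?_⟩
  rw [ENNReal.coe_toNNReal hsum]
  set S : ℕ → Set (sphere (0 : EuclideanSpace ℝ (Fin d)) 1) := fun j =>
    {θ | ‖e - (θ : EuclideanSpace ℝ (Fin d))‖ < 4 * (2 ^ j)⁻¹} with hS
  have hSm : ∀ j, MeasurableSet (S j) := fun j =>
    (isOpen_lt (by fun_prop) (by fun_prop)).measurableSet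
  have hpt : ∀ θ : sphere (0 : EuclideanSpace ℝ (Fin d)) 1,
      ENNReal.ofReal (‖e - (θ : EuclideanSpace ℝ (Fin d))‖ ^ (-γ)) ≤
        ∑' j : ℕ, (S j).indicator (fun _ => ENNReal.ofReal ((2 ^ γ) ^ j)) θ := by
    intro θ
    set x := ‖e - (θ : EuclideanSpace ℝ (Fin d))‖ with hx
    have hx2 : x ≤ 2 := by
      refine (norm_sub_le _ _).trans ?_
      rw [he, norm_eq_of_mem_sphere θ]; norm_num
    obtain h0 | h0 := (norm_nonneg (e - (θ : EuclideanSpace ℝ (Fin d)))).eq_or_lt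
    -- At distance zero the real power `0 ^ (-γ)` takes a default value at most `1`, which the term
    -- `j = 0` absorbs.
    · refine le_trans ?_ (ENNReal.le_tsum 0)
      rw [indicator_of_mem (by simp [hS, ← h0])]
      simp only [pow_zero]
      apply ENNReal.ofReal_le_ofReal
      rw [hx, ← h0]
      exact Real.zero_rpow_le_one _
    · rw [← hx] at h0
      obtain ⟨n, hn, hn'⟩ := exists_nat_pow_near_of_lt_one (x := x / 2) (y := 1 / 2)
        (by positivity) (by linarith) (by norm_num) (by norm_num)
      rw [pow_succ, one_div, inv_pow] at hn
      rw [one_div, inv_pow] at hn'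
      refine le_trans ?_ (ENNReal.le_tsum n)
      have hp : (0 : ℝ) < (2 ^ n)⁻¹ := by positivity
      rw [indicator_of_mem (by rw [hS, mem_ofPred_eq, ← hx]; linarith)]
      apply ENNReal.ofReal_le_ofReal
      calc x ^ (-γ) ≤ ((2 ^ n)⁻¹ : ℝ) ^ (-γ) :=
            Real.rpow_le_rpow_of_nonpos hp (by linarith) (by linarith)
        _ = (2 ^ γ) ^ n := by
            rw [Real.inv_rpow (by positivity), Real.rpow_neg (by positivity), inv_inv,
              ← Real.rpow_natCast, ← Real.rpow_natCast, ← Real.rpow_mul (by norm_num),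
              ← Real.rpow_mul (by norm_num), mul_comm]
  calc _ ≤ ∫⁻ θ, ∑' j : ℕ, (S j).indicator (fun _ => ENNReal.ofReal ((2 ^ γ) ^ j)) θ
        ∂(volume : Measure (EuclideanSpace ℝ (Fin d))).toSphere := lintegral_mono hpt
    _ = ∑' j : ℕ, ENNReal.ofReal ((2 ^ γ) ^ j) *
        (volume : Measure (EuclideanSpace ℝ (Fin d))).toSphere (S j) := by
        rw [lintegral_tsum fun j => (measurable_const.indicator (hSm j)).aemeasurable]
        congr 1; ext j
        rw [lintegral_indicator_const (hSm j)]
    _ ≤ _ := by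
        refine ENNReal.tsum_le_tsum fun j => ?_
        refine (mul_le_mul_right (toSphere_cap_le hd e he (by positivity) ?_) _).trans_eq ?_
        · have : ((2 : ℝ) ^ j)⁻¹ ≤ 1 := inv_le_one_of_one_le₀ (one_le_pow₀ (by norm_num))
          linarith
        · rw [← mul_assoc, ← ENNReal.ofReal_mul (by positivity)]
          congr 2
          rw [hc, hq, Real.rpow_sub (by norm_num), div_pow, mul_pow, inv_pow, ← pow_mul,
            show ((d : ℝ) - 1) = ((d - 1 : ℕ) : ℝ) by rw [Nat.cast_sub hd]; simp,
            Real.rpow_natCast, ← pow_mul, mul_comm j]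
          field_simp

/-! ### Pointwise bounds for the weight. -/

theorem Real.rpow_le_of_mem_Icc_third {t M p : ℝ} (hM : 0 < M) (h1 : M / 3 ≤ t) (h2 : t ≤ 3 * M) :
    t ^ p ≤ 3 ^ |p| * M ^ p := by
  have ht : 0 < t := by linarith
  have hm : t = t / M * M := by field_simp
  have h3 : 0 < t / M := by positivity
  rw [hm, Real.mul_rpow h3.le hM.le]
  refine mul_le_mul_of_nonneg_right ?_ (by positivity)
  obtain hp | hp := le_total 0 p
  · rw [abs_of_nonneg hp]
    exact Real.rpow_le_rpow h3.le (by rw [div_le_iff₀ hM]; exact h2) hp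
  · rw [abs_of_nonpos hp]
    calc (t / M) ^ p ≤ (1 / 3) ^ p := Real.rpow_le_rpow_of_nonpos (by norm_num)
          (by rw [le_div_iff₀ hM]; linarith) hp
      _ = 3 ^ (-p) := by rw [one_div, Real.inv_rpow (by norm_num), Real.rpow_neg (by norm_num)]

/-- For `α ≥ 0` the lower bound on `x` is used, for `α ≤ 0` the upper one. In both cases the loss is
at most `(E / 2) ^ (-γ)`, which is at least `1` because `E ≤ 2`. -/
theorem Real.rpow_neg_le_of_mul_le {x r E α γ : ℝ} (hr : 0 < r) (hE : 0 < E) (hE2 : E ≤ 2)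
    (hx : r * E / 2 ≤ x) (hx3 : x ≤ 3 * r) (hγ : 0 ≤ γ) (hα : α ≤ γ) :
    x ^ (-α) ≤ 3 ^ |α| * r ^ (-α) * (2 ^ γ * E ^ (-γ)) := by
  have hx0 : 0 < x := lt_of_lt_of_le (by positivity) hx
  have hE' : 2 ^ γ * E ^ (-γ) = (E / 2) ^ (-γ) := by
    rw [Real.div_rpow hE.le (by norm_num), Real.rpow_neg (by norm_num : (0 : ℝ) ≤ 2), div_inv_eq_mul,
      mul_comm]
  rw [hE']
  have h1 : 1 ≤ (3 : ℝ) ^ |α| := Real.one_le_rpow (by norm_num) (abs_nonneg _)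
  have h2 : 1 ≤ (E / 2) ^ (-γ) :=
    Real.one_le_rpow_of_pos_of_le_one_of_nonpos (by positivity) (by linarith) (by linarith)
  obtain h0 | h0 := le_total 0 α
  · calc x ^ (-α) ≤ (r * (E / 2)) ^ (-α) :=
          Real.rpow_le_rpow_of_nonpos (by positivity) (by linarith) (by linarith)
      _ = 1 * r ^ (-α) * (E / 2) ^ (-α) := by
          rw [Real.mul_rpow hr.le (by positivity), one_mul]
      _ ≤ 3 ^ |α| * r ^ (-α) * (E / 2) ^ (-γ) := by
          gcongr ?_ * _ * ?_
          exact Real.rpow_le_rpow_of_exponent_ge (by positivity) (by linarith) (by linarith)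
  · calc x ^ (-α) ≤ (3 * r) ^ (-α) := Real.rpow_le_rpow hx0.le hx3 (by linarith)
      _ = 3 ^ |α| * r ^ (-α) * 1 := by
          rw [Real.mul_rpow (by norm_num) hr.le, abs_of_nonpos h0, mul_one]
      _ ≤ _ := by gcongr

/-- To be used with `x = ‖rθ - a‖`, `y = ‖rθ + a‖`, `M = ‖a‖ + r`, and `E`, `E'` the distances from
`θ` to the two poles `±a/‖a‖`. If `3r < M`, both factors are comparable to `M`, and `r ≤ M` with `α
+ β ≥ 0` suffices. Otherwise `M` is comparable to `r`, one factor is comparable to `r` as well, and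
only the other can be singular, so a sum rather than a product of singularities appears. -/
theorem Real.rpow_neg_mul_rpow_neg_le {α β γ r M x y E E' : ℝ} (hr : 0 < r) (hrM : r ≤ M)
    (hxM : x ≤ M) (hyM : y ≤ M) (hmax : M / 2 ≤ x ∨ M / 2 ≤ y) (hE : 0 < E) (hE2 : E ≤ 2)
    (hE' : 0 < E') (hE2' : E' ≤ 2) (hx : r * E / 2 ≤ x) (hy : r * E' / 2 ≤ y)
    (hfar : 3 * r < M → M / 3 ≤ x ∧ M / 3 ≤ y) (hγ : 0 ≤ γ) (hα : α ≤ γ) (hβ : β ≤ γ)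
    (hαβ : 0 ≤ α + β) :
    x ^ (-α) * y ^ (-β) * r ^ (α + β) ≤
      3 ^ |α| * 3 ^ |β| * 2 ^ γ * (E ^ (-γ) + E' ^ (-γ)) := by
  have hM : 0 < M := hr.trans_le hrM
  have hx0 : 0 < x := lt_of_lt_of_le (by positivity) hx
  have hy0 : 0 < y := lt_of_lt_of_le (by positivity) hy
  have hr1 : r ^ (-α) * r ^ (-β) * r ^ (α + β) = 1 := by
    rw [← Real.rpow_add hr, ← Real.rpow_add hr]; ring_nf; simp
  have key : ∀ {F : ℝ}, 0 < F → 0 ≤ F ^ (-γ) := fun h => by positivity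
  obtain h | h := lt_or_ge (3 * r) M
  · obtain ⟨h1, h2⟩ := hfar h
    have hx' := Real.rpow_le_of_mem_Icc_third (p := -α) hM h1 (by linarith)
    have hy' := Real.rpow_le_of_mem_Icc_third (p := -β) hM h2 (by linarith)
    rw [abs_neg] at hx' hy'
    have hrM' : r ^ (α + β) ≤ M ^ (α + β) := Real.rpow_le_rpow hr.le hrM hαβ
    have hM1 : M ^ (-α) * M ^ (-β) * M ^ (α + β) = 1 := by
      rw [← Real.rpow_add hM, ← Real.rpow_add hM]; ring_nf; simp
    have hone : 1 ≤ 2 ^ γ * E ^ (-γ) := by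
      rw [Real.rpow_neg hE.le, ← div_eq_mul_inv, ← Real.div_rpow (by norm_num) hE.le]
      exact Real.one_le_rpow (by rw [le_div_iff₀ hE]; linarith) hγ
    calc x ^ (-α) * y ^ (-β) * r ^ (α + β)
        ≤ (3 ^ |α| * M ^ (-α)) * (3 ^ |β| * M ^ (-β)) * M ^ (α + β) := by gcongr
      _ = 3 ^ |α| * 3 ^ |β| * (M ^ (-α) * M ^ (-β) * M ^ (α + β)) := by ring
      _ = 3 ^ |α| * 3 ^ |β| * 1 := by rw [hM1]
      _ ≤ 3 ^ |α| * 3 ^ |β| * (2 ^ γ * E ^ (-γ) + 2 ^ γ * E' ^ (-γ)) := by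
          gcongr
          have : 0 ≤ 2 ^ γ * E' ^ (-γ) := by positivity
          linarith
      _ = _ := by ring
  · have hx1 := Real.rpow_neg_le_of_mul_le hr hE hE2 hx (by linarith) hγ hα
    have hy1 := Real.rpow_neg_le_of_mul_le hr hE' hE2' hy (by linarith) hγ hβ
    obtain hm | hm := hmax
    · have hx' := Real.rpow_le_of_mem_Icc_third (p := -α) hr (by linarith : r / 3 ≤ x) (by linarith)
      rw [abs_neg] at hx'
      calc x ^ (-α) * y ^ (-β) * r ^ (α + β)
          ≤ (3 ^ |α| * r ^ (-α)) * (3 ^ |β| * r ^ (-β) * (2 ^ γ * E' ^ (-γ))) * r ^ (α + β) := by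
            gcongr
        _ = 3 ^ |α| * 3 ^ |β| * 2 ^ γ * E' ^ (-γ) * (r ^ (-α) * r ^ (-β) * r ^ (α + β)) := by ring
        _ ≤ _ := by
            rw [hr1, mul_one]
            gcongr
            exact le_add_of_nonneg_left (key hE)
    · have hy' := Real.rpow_le_of_mem_Icc_third (p := -β) hr (by linarith : r / 3 ≤ y) (by linarith)
      rw [abs_neg] at hy'
      calc x ^ (-α) * y ^ (-β) * r ^ (α + β)
          ≤ (3 ^ |α| * r ^ (-α) * (2 ^ γ * E ^ (-γ))) * (3 ^ |β| * r ^ (-β)) * r ^ (α + β) := by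
            gcongr
        _ = 3 ^ |α| * 3 ^ |β| * 2 ^ γ * E ^ (-γ) * (r ^ (-α) * r ^ (-β) * r ^ (α + β)) := by ring
        _ ≤ _ := by
            rw [hr1, mul_one]
            gcongr
            exact le_add_of_nonneg_right (key hE')

/-! ### Polar coordinates, spherical averages of the weight, and the coarea bound. -/

open Metric Set in
/-- Integration in polar coordinates for the Lebesgue integral of nonnegative functions. -/
theorem lintegral_eq_lintegral_toSphere {d : ℕ} (hd : 1 ≤ d)
    {f : EuclideanSpace ℝ (Fin d) → ℝ≥0∞} (hf : Measurable f) :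
    ∫⁻ x, f x = ∫⁻ r in Ioi (0 : ℝ), ENNReal.ofReal (r ^ (d - 1)) *
      ∫⁻ θ, f (r • (θ : EuclideanSpace ℝ (Fin d)))
        ∂(volume : Measure (EuclideanSpace ℝ (Fin d))).toSphere := by
  have : Nontrivial (EuclideanSpace ℝ (Fin d)) := by
    have : Nonempty (Fin d) := ⟨⟨0, hd⟩⟩
    infer_instance
  have hmp := (volume : Measure (EuclideanSpace ℝ (Fin d))).measurePreserving_homeomorphUnitSphereProd
  have hmeas : Measurable fun p : sphere (0 : EuclideanSpace ℝ (Fin d)) 1 × Ioi (0 : ℝ) =>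
      f (p.2.1 • p.1.1) := hf.comp (by fun_prop)
  calc ∫⁻ x, f x = ∫⁻ x in {(0 : EuclideanSpace ℝ (Fin d))}ᶜ, f x := by
        rw [restrict_compl_singleton]
    _ = ∫⁻ x : ({0}ᶜ : Set (EuclideanSpace ℝ (Fin d))), f x ∂(volume.comap Subtype.val) :=
        (lintegral_subtype_comap (measurableSet_singleton _).compl _).symm
    _ = ∫⁻ x : ({0}ᶜ : Set (EuclideanSpace ℝ (Fin d))),
          (fun p : sphere (0 : EuclideanSpace ℝ (Fin d)) 1 × Ioi (0 : ℝ) => f (p.2.1 • p.1.1))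
            (homeomorphUnitSphereProd _ x) ∂(volume.comap Subtype.val) := by
        congr 1; ext x
        have := (homeomorphUnitSphereProd (EuclideanSpace ℝ (Fin d))).symm_apply_apply x
        conv_lhs => rw [← this]
        rfl
    _ = _ := by
        rw [hmp.lintegral_comp hmeas, lintegral_prod_symm _ hmeas.aemeasurable,
          Measure.volumeIoiPow, lintegral_withDensity_eq_lintegral_mul _ (by fun_prop)
            hmeas.lintegral_prod_left', finrank_euclideanSpace_fin]
        exact lintegral_subtype_comap measurableSet_Ioi
          (fun r : ℝ => ENNReal.ofReal (r ^ (d - 1)) *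
            ∫⁻ θ, f (r • (θ : EuclideanSpace ℝ (Fin d)))
              ∂(volume : Measure (EuclideanSpace ℝ (Fin d))).toSphere)

-- A point lies in caps of every radius `ε`, whose measure is `O(ε ^ (d - 1))`; this tends to zero
-- as `d ≥ 2`.
open Metric Set in
theorem toSphere_singleton {d : ℕ} (hd : 2 ≤ d)
    (e : sphere (0 : EuclideanSpace ℝ (Fin d)) 1) :
    (volume : Measure (EuclideanSpace ℝ (Fin d))).toSphere {e} = 0 := by
  have hlim : Filter.Tendsto (fun ε : ℝ => ENNReal.ofReal (d * 9 * 2 ^ d * ε ^ (d - 1 : ℕ)) *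
      volume (ball (0 : EuclideanSpace ℝ (Fin d)) 1)) (nhdsWithin 0 (Ioi 0)) (nhds 0) := by
    have h1 : Filter.Tendsto (fun ε : ℝ => d * 9 * 2 ^ d * ε ^ (d - 1 : ℕ))
        (nhdsWithin 0 (Ioi 0)) (nhds 0) := by
      have : Continuous fun ε : ℝ => (d * 9 * 2 ^ d * ε ^ (d - 1 : ℕ) : ℝ) := by fun_prop
      have h := (this.tendsto 0).mono_left (nhdsWithin_le_nhds (s := Ioi 0))
      rwa [zero_pow (by omega), mul_zero] at h
    have h2 := ENNReal.Tendsto.mul_const (ENNReal.tendsto_ofReal h1)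
      (Or.inr (measure_ball_lt_top (μ := volume) (x := (0 : EuclideanSpace ℝ (Fin d))) (r := 1)).ne)
    rwa [ENNReal.ofReal_zero, zero_mul] at h2
  have hev : ∀ᶠ ε : ℝ in nhdsWithin 0 (Ioi 0),
      (volume : Measure (EuclideanSpace ℝ (Fin d))).toSphere {e} ≤
        ENNReal.ofReal (d * 9 * 2 ^ d * ε ^ (d - 1 : ℕ)) *
      volume (ball (0 : EuclideanSpace ℝ (Fin d)) 1) := by
    filter_upwards [Ioo_mem_nhdsGT (show (0 : ℝ) < 4 by norm_num)] with ε hε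
    refine (measure_mono ?_).trans (toSphere_cap_le (by omega) (e : EuclideanSpace ℝ (Fin d)) (norm_eq_of_mem_sphere e) hε.1 hε.2.le)
    rintro θ rfl
    simpa using hε.1
  exact le_antisymm (ge_of_tendsto hlim hev) bot_le

open Metric Set in
/-- Uniform bound for the spherical averages of the weight occurring in the bilinear estimate. -/
theorem exists_lintegral_toSphere_weight_le {d : ℕ} (hd : 2 ≤ d) {α β : ℝ} (hα : α < d - 1)
    (hβ : β < d - 1) (hαβ : α + β = d - 2) :
    ∃ C : ℝ≥0, ∀ a : EuclideanSpace ℝ (Fin d), ∀ r : ℝ, 0 < r →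
      ENNReal.ofReal (r ^ (d - 2)) *
        ∫⁻ θ, ENNReal.ofReal (‖r • (θ : EuclideanSpace ℝ (Fin d)) - a‖ ^ (-α) *
          ‖r • (θ : EuclideanSpace ℝ (Fin d)) + a‖ ^ (-β))
          ∂(volume : Measure (EuclideanSpace ℝ (Fin d))).toSphere ≤ C := by
  -- A single nonnegative exponent dominating both `α` and `β`, still below `d - 1`, so that one
  -- singular integral on the sphere serves both poles.
  set γ : ℝ := max (max α β) 0 with hγ
  have hd' : (2 : ℝ) ≤ d := by exact_mod_cast hd
  have hγd : γ < d - 1 := max_lt (max_lt hα hβ) (by linarith)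
  have hγ0 : 0 ≤ γ := le_max_right _ _
  have hαγ : α ≤ γ := (le_max_left _ _).trans (le_max_left _ _)
  have hβγ : β ≤ γ := (le_max_right _ _).trans (le_max_left _ _)
  obtain ⟨C, hC⟩ := exists_lintegral_toSphere_rpow_le (by omega) hγ0 hγd
  set K : ℝ := 3 ^ |α| * 3 ^ |β| * 2 ^ γ with hK
  have hK0 : 0 ≤ K := by positivity
  refine ⟨K.toNNReal * (C + C), fun a r hr => ?_⟩
  have : Nonempty (Fin d) := ⟨⟨0, by omega⟩⟩
  obtain ⟨e, he, hae⟩ : ∃ e : EuclideanSpace ℝ (Fin d), ‖e‖ = 1 ∧ a = ‖a‖ • e := by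
    by_cases h : a = 0
    · obtain ⟨e, he⟩ := exists_norm_eq (EuclideanSpace ℝ (Fin d)) zero_le_one
      exact ⟨e, he, by simp [h]⟩
    · refine ⟨‖a‖⁻¹ • a, norm_smul_inv_norm (𝕜 := ℝ) h, ?_⟩
      rw [smul_smul, mul_inv_cancel₀ (norm_ne_zero_iff.2 h), one_smul]
  have hne : ∀ᵐ θ : sphere (0 : EuclideanSpace ℝ (Fin d)) 1 ∂(volume : Measure (EuclideanSpace ℝ (Fin d))).toSphere,
      (θ : EuclideanSpace ℝ (Fin d)) ≠ e ∧ (θ : EuclideanSpace ℝ (Fin d)) ≠ -e := by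
    rw [ae_iff]
    refine measure_mono_null (t := {⟨e, by simpa using he⟩, ⟨-e, by simpa using he⟩}) ?_ ?_
    · intro θ hθ
      simp only [mem_ofPred_eq, not_and_or, not_not] at hθ
      simpa [Subtype.ext_iff] using hθ
    · rw [insert_eq]
      exact measure_union_null (toSphere_singleton hd _) (toSphere_singleton hd _)
  have hpt : ∀ᵐ θ : sphere (0 : EuclideanSpace ℝ (Fin d)) 1 ∂(volume : Measure (EuclideanSpace ℝ (Fin d))).toSphere,
      ENNReal.ofReal (r ^ (d - 2)) *
      ENNReal.ofReal (‖r • (θ : EuclideanSpace ℝ (Fin d)) - a‖ ^ (-α) *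
          ‖r • (θ : EuclideanSpace ℝ (Fin d)) + a‖ ^ (-β)) ≤
        ENNReal.ofReal K * (ENNReal.ofReal (‖e - (θ : EuclideanSpace ℝ (Fin d))‖ ^ (-γ)) +
          ENNReal.ofReal (‖-e - (θ : EuclideanSpace ℝ (Fin d))‖ ^ (-γ))) := by
    filter_upwards [hne] with θ hθ
    have hθ1 : ‖(θ : EuclideanSpace ℝ (Fin d))‖ = 1 := norm_eq_of_mem_sphere θ
    have hrθ : ‖r • (θ : EuclideanSpace ℝ (Fin d))‖ = r := by
      rw [norm_smul, hθ1, Real.norm_of_nonneg hr.le, mul_one]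
    have hrpow : r ^ (d - 2) = r ^ (α + β) := by
      rw [hαβ, ← Real.rpow_natCast, Nat.cast_sub hd, Nat.cast_ofNat]
    have habs : |(‖a‖ : ℝ) - r| ≤ ‖r • (θ : EuclideanSpace ℝ (Fin d)) - a‖ := by
      have := abs_norm_sub_norm_le a (r • (θ : EuclideanSpace ℝ (Fin d)))
      rwa [hrθ, norm_sub_rev] at this
    have habs' : |(‖a‖ : ℝ) - r| ≤ ‖r • (θ : EuclideanSpace ℝ (Fin d)) + a‖ := by
      have := abs_norm_sub_norm_le a (-(r • (θ : EuclideanSpace ℝ (Fin d))))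
      rwa [norm_neg, hrθ, sub_neg_eq_add, add_comm] at this
    rw [← ENNReal.ofReal_add (by positivity) (by positivity), ← ENNReal.ofReal_mul (by positivity),
      ← ENNReal.ofReal_mul hK0, mul_comm, hrpow]
    apply ENNReal.ofReal_le_ofReal
    refine Real.rpow_neg_mul_rpow_neg_le (M := ‖a‖ + r) hr (by linarith [norm_nonneg a]) ?_ ?_ ?_
      (norm_pos_iff.2 (sub_ne_zero.2 hθ.1.symm)) ?_ (norm_pos_iff.2 (sub_ne_zero.2 hθ.2.symm)) ?_
      ?_ ?_ ?_ hγ0 hαγ hβγ (by linarith)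
    · linarith [norm_sub_le (r • (θ : EuclideanSpace ℝ (Fin d))) a]
    · linarith [norm_add_le (r • (θ : EuclideanSpace ℝ (Fin d))) a]
    -- The sum of the two norms is at least `2r` and at least `2‖a‖`, hence at least `‖a‖ + r`, so
    -- they cannot both be below half of it.
    · by_contra! h
      have h1 := norm_add_le (r • (θ : EuclideanSpace ℝ (Fin d)) - a) (r • (θ : EuclideanSpace ℝ (Fin d)) + a)
      have h2 := norm_sub_le (r • (θ : EuclideanSpace ℝ (Fin d)) + a) (r • (θ : EuclideanSpace ℝ (Fin d)) - a)
      rw [sub_add_add_cancel, ← two_smul ℝ, norm_smul, hrθ, Real.norm_of_nonneg (by norm_num)] at h1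
      rw [add_sub_sub_cancel, ← two_smul ℝ, norm_smul, Real.norm_of_nonneg (by norm_num)] at h2
      linarith
    · linarith [norm_sub_le e (θ : EuclideanSpace ℝ (Fin d))]
    · have := norm_sub_le (-e) (θ : EuclideanSpace ℝ (Fin d))
      rw [norm_neg] at this
      linarith
    -- Here `r‖θ - e‖ ≤ ‖rθ - a‖ + |‖a‖ - r|`, and the last term is itself at most `‖rθ - a‖`; this
    -- is the factor `1/2` in the lower bound.
    · have h1 : r • (θ - e : EuclideanSpace ℝ (Fin d)) = (r • (θ : EuclideanSpace ℝ (Fin d)) - a) + (‖a‖ - r) • e := by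
        nth_rw 1 [hae]; module
      have h2 := norm_add_le (r • (θ : EuclideanSpace ℝ (Fin d)) - a) ((‖a‖ - r) • e)
      rw [← h1, norm_smul, norm_smul, he, Real.norm_of_nonneg hr.le, Real.norm_eq_abs, norm_sub_rev] at h2
      linarith
    · have h1 : r • (θ - -e : EuclideanSpace ℝ (Fin d)) = (r • (θ : EuclideanSpace ℝ (Fin d)) + a) - (‖a‖ - r) • e := by
        nth_rw 1 [hae]; module
      have h2 := norm_sub_le (r • (θ : EuclideanSpace ℝ (Fin d)) + a) ((‖a‖ - r) • e)
      rw [← h1, norm_smul, norm_smul, he, Real.norm_of_nonneg hr.le, Real.norm_eq_abs, norm_sub_rev] at h2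
      linarith
    · intro h
      have := le_abs_self (‖a‖ - r)
      constructor <;> linarith
  rw [← lintegral_const_mul' _ _ ENNReal.ofReal_ne_top]
  refine (lintegral_mono_ae hpt).trans ?_
  rw [lintegral_const_mul' _ _ ENNReal.ofReal_ne_top, lintegral_add_left' (by fun_prop)]
  push_cast
  gcongr
  · exact le_rfl
  · exact hC e he
  · exact hC (-e) (by simpa using he)

-- Substitution `ρ = 4πr² + c`, whose Jacobian `8πr` is at least `r`.
open Set in
theorem lintegral_Ioi_mul_sq_add_le (c : ℝ) (φ : ℝ → ℝ≥0∞) :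
    ∫⁻ r in Ioi (0 : ℝ), ENNReal.ofReal r * φ (4 * Real.pi * r ^ 2 + c) ≤ ∫⁻ ρ, φ ρ := by
  have hpi := Real.pi_pos
  have h := lintegral_image_eq_lintegral_abs_deriv_mul (s := Ioi (0 : ℝ)) measurableSet_Ioi
    (f := fun r => 4 * Real.pi * r ^ 2 + c) (f' := fun r => 8 * Real.pi * r)
    (fun r _ => by
      refine (((hasDerivAt_pow 2 r).const_mul (4 * Real.pi)).add_const c).hasDerivWithinAt.congr_deriv ?_
      push_cast; ring)
    (fun x hx y hy hxy => by
      have : x ^ 2 = y ^ 2 := by simpa [hpi.ne'] using hxy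
      exact (pow_left_inj₀ (le_of_lt hx) (le_of_lt hy) two_ne_zero).1 this) φ
  calc ∫⁻ r in Ioi (0 : ℝ), ENNReal.ofReal r * φ (4 * Real.pi * r ^ 2 + c)
      ≤ ∫⁻ r in Ioi (0 : ℝ), ENNReal.ofReal |8 * Real.pi * r| * φ (4 * Real.pi * r ^ 2 + c) := by
        refine setLIntegral_mono' measurableSet_Ioi fun r hr => ?_
        gcongr
        have hr' : (0 : ℝ) < r := hr
        rw [abs_of_nonneg (by positivity)]
        nlinarith [Real.pi_gt_three]
    _ = ∫⁻ ρ in (fun r => 4 * Real.pi * r ^ 2 + c) '' Ioi 0, φ ρ := h.symm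
    _ ≤ ∫⁻ ρ, φ ρ := setLIntegral_le_lintegral _ _

/-- In polar coordinates the density splits as `r^(d-1) = r^(d-2) · r`: the first factor bounds the
spherical average, the second is the Jacobian of the radial substitution. -/
theorem exists_lintegral_weight_comp_sq_le {d : ℕ} (hd : 2 ≤ d) {α β : ℝ} (hα : α < d - 1)
    (hβ : β < d - 1) (hαβ : α + β = d - 2) :
    ∃ C : ℝ≥0, ∀ a : EuclideanSpace ℝ (Fin d), ∀ c : ℝ, ∀ φ : ℝ → ℝ≥0∞, Measurable φ →
      ∫⁻ η : EuclideanSpace ℝ (Fin d), ENNReal.ofReal (‖η - a‖ ^ (-α) * ‖η + a‖ ^ (-β)) *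
        φ (4 * Real.pi * ‖η‖ ^ 2 + c) ≤ C * ∫⁻ ρ, φ ρ := by
  obtain ⟨C, hC⟩ := exists_lintegral_toSphere_weight_le hd hα hβ hαβ
  refine ⟨C, fun a c φ hφ => ?_⟩
  rw [lintegral_eq_lintegral_toSphere (by omega) (by fun_prop)]
  calc _ ≤ ∫⁻ r in Set.Ioi (0 : ℝ), C * (ENNReal.ofReal r * φ (4 * Real.pi * r ^ 2 + c)) := by
        refine setLIntegral_mono' measurableSet_Ioi fun r hr => ?_
        have hr' : (0 : ℝ) < r := hr
        have hn : ∀ θ : Metric.sphere (0 : EuclideanSpace ℝ (Fin d)) 1,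
            ‖r • (θ : EuclideanSpace ℝ (Fin d))‖ = r := fun θ => by
          rw [norm_smul, norm_eq_of_mem_sphere θ, Real.norm_of_nonneg hr'.le, mul_one]
        simp_rw [hn]
        rw [lintegral_mul_const _ (by fun_prop), show d - 1 = (d - 2) + 1 by omega, pow_succ,
          ENNReal.ofReal_mul (by positivity)]
        calc _ = (ENNReal.ofReal (r ^ (d - 2)) *
                ∫⁻ θ, ENNReal.ofReal (‖r • (θ : EuclideanSpace ℝ (Fin d)) - a‖ ^ (-α) *
                ‖r • (θ : EuclideanSpace ℝ (Fin d)) + a‖ ^ (-β))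
                ∂(volume : Measure (EuclideanSpace ℝ (Fin d))).toSphere) *
                (ENNReal.ofReal r * φ (4 * Real.pi * r ^ 2 + c)) := by ring
          _ ≤ _ := by gcongr; exact hC a r hr'
    _ ≤ _ := by
        rw [lintegral_const_mul _ (by fun_prop)]
        exact mul_le_mul_right (lintegral_Ioi_mul_sq_add_le c φ) _

/-- A locally integrable function whose pairing with Schwartz functions is bounded in the `L²` norm
is itself in `L²`. -/
theorem eLpNorm_two_le_of_forall_schwartz {V : Type*} [NormedAddCommGroup V] [InnerProductSpace ℝ V]
    [FiniteDimensional ℝ V] [MeasurableSpace V] [BorelSpace V] {f : V → ℂ}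
    (hf : LocallyIntegrable f volume) (A : ℝ≥0)
    (hi : ∀ χ : 𝓢(V, ℂ), Integrable (fun x => χ x * f x) volume)
    (h : ∀ χ : 𝓢(V, ℂ), ‖∫ x, χ x * f x‖ₑ ≤ A * eLpNorm χ 2 volume) :
    eLpNorm f 2 volume ≤ A := by
  let Λ : 𝓢(V, ℂ) →ₗ[ℂ] ℂ :=
    -- The pairing extends by density to a bounded functional on `L²`; its Riesz representative
    -- agrees with the conjugate of `f` almost everywhere, by testing against smooth compactly
    -- supported functions.
    { toFun := fun χ => ∫ x, χ x * f x
      map_add' := fun χ χ' => by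
        simp only [_root_.add_apply, add_mul]
        exact integral_add (hi χ) (hi χ')
      map_smul' := fun c χ => by
        simp only [_root_.smul_apply, smul_eq_mul, mul_assoc, RingHom.id_apply]
        exact integral_const_mul _ _ }
  let e : 𝓢(V, ℂ) →ₗ[ℂ] Lp ℂ 2 (volume : Measure V) :=
    (SchwartzMap.toLpCLM ℂ ℂ 2 (volume : Measure V)).toLinearMap
  have he : DenseRange e := SchwartzMap.denseRange_toLpCLM ENNReal.ofNat_ne_top
  have hbd : ∀ χ, ‖Λ χ‖ ≤ A * ‖e χ‖ := by
    intro χ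
    have h1 := h χ
    have h2 : ‖e χ‖ₑ = eLpNorm χ 2 volume := by
      rw [Lp.enorm_def]
      exact eLpNorm_congr_ae (SchwartzMap.coeFn_toLp χ 2 volume)
    rw [← h2, ← ofReal_norm, ← ofReal_norm, ← ENNReal.ofReal_coe_nnreal,
      ← ENNReal.ofReal_mul A.coe_nonneg] at h1
    exact (ENNReal.ofReal_le_ofReal_iff (by positivity)).1 h1
  let L := Λ.extendOfNorm e
  have hL : ∀ χ, L (e χ) = Λ χ := LinearMap.extendOfNorm_eq he ⟨A, hbd⟩
  have hLn : ‖L‖ ≤ A := LinearMap.opNorm_extendOfNorm_le he A.2 hbd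
  obtain ⟨g, hg⟩ : ∃ g, InnerProductSpace.toDual ℂ _ g = L := ⟨_, LinearIsometryEquiv.apply_symm_apply _ L⟩
  have hgn : ‖g‖ = ‖L‖ := by rw [← hg]; simp
  have hgm : MemLp g 2 volume := Lp.memLp g
  have hae : f =ᵐ[volume] fun x => starRingEnd ℂ (g x) := by
    refine ae_eq_of_integral_contDiff_smul_eq hf
      ((hgm.star.locallyIntegrable (by norm_num))) ?_
    intro φ hφ hφc
    let χ : 𝓢(V, ℂ) := (hφc.comp_left (g := Complex.ofReal) rfl).toSchwartzMap
      (Complex.ofRealCLM.contDiff.comp hφ)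
    have hχ : ∀ x, χ x = φ x := fun x => rfl
    have h1 : L (e χ) = ∫ x, χ x * starRingEnd ℂ (g x) := by
      rw [← hg, InnerProductSpace.toDual_apply_apply, L2.inner_def]
      refine integral_congr_ae ?_
      filter_upwards [SchwartzMap.coeFn_toLp χ 2 (volume : Measure V)] with x hx
      change inner ℂ (g x) (e χ x) = _
      rw [show e χ x = χ x from hx]
      simp
    have h2 := (hL χ).symm.trans h1
    simpa [Λ, hχ] using h2
  calc eLpNorm f 2 volume = eLpNorm g 2 volume := by
        rw [eLpNorm_congr_ae hae]
        exact eLpNorm_congr_norm_ae (.of_forall fun x => by simp)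
    _ = ‖g‖ₑ := (Lp.enorm_def g).symm
    _ ≤ A := by
        rw [← ofReal_norm, hgn, ← ENNReal.ofReal_coe_nnreal]
        exact ENNReal.ofReal_le_ofReal hLn

/-- Coarea-type bound behind the bilinear estimate: the weighted push-forward of Lebesgue measure
under `(ξ, η) ↦ (2π(|ξ|² + |η|²), -(ξ + η))` has bounded density. -/
theorem exists_lintegral_paraboloid_le {d : ℕ} (hd : 2 ≤ d) {α β : ℝ} (hα : α < d - 1)
    (hβ : β < d - 1) (hαβ : α + β = d - 2) :
    ∃ C : ℝ≥0, ∀ Φ : ℝ × EuclideanSpace ℝ (Fin d) → ℝ≥0∞, Measurable Φ →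
      ∫⁻ p : EuclideanSpace ℝ (Fin d) × EuclideanSpace ℝ (Fin d),
        ENNReal.ofReal (‖p.1‖ ^ (-α) * ‖p.2‖ ^ (-β)) *
          Φ (2 * Real.pi * (‖p.1‖ ^ 2 + ‖p.2‖ ^ 2), -(p.1 + p.2)) ≤ C * ∫⁻ z, Φ z := by
  obtain ⟨C, hC⟩ := exists_lintegral_weight_comp_sq_le hd hα hβ hαβ
  refine ⟨C, fun Φ hΦ => ?_⟩
  have hm : Measurable fun p : EuclideanSpace ℝ (Fin d) × EuclideanSpace ℝ (Fin d) =>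
        ENNReal.ofReal (‖p.1‖ ^ (-α) * ‖p.2‖ ^ (-β)) *
          Φ (2 * Real.pi * (‖p.1‖ ^ 2 + ‖p.2‖ ^ 2), -(p.1 + p.2)) := by fun_prop
  rw [Measure.volume_eq_prod, lintegral_prod _ hm.aemeasurable, Measure.volume_eq_prod,
    lintegral_prod_symm' _ hΦ]
  calc _ = ∫⁻ ξ : EuclideanSpace ℝ (Fin d), ∫⁻ p : EuclideanSpace ℝ (Fin d),
        ENNReal.ofReal (‖ξ‖ ^ (-α) * ‖-ξ - p‖ ^ (-β)) *
          Φ (2 * Real.pi * (‖ξ‖ ^ 2 + ‖-ξ - p‖ ^ 2), -(ξ + (-ξ - p))) := by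
        refine lintegral_congr fun ξ => ?_
        exact (lintegral_sub_left_eq_self (fun η => ENNReal.ofReal (‖ξ‖ ^ (-α) * ‖η‖ ^ (-β)) *
          Φ (2 * Real.pi * (‖ξ‖ ^ 2 + ‖η‖ ^ 2), -(ξ + η))) (-ξ)).symm
    _ = ∫⁻ p : EuclideanSpace ℝ (Fin d), ∫⁻ ξ : EuclideanSpace ℝ (Fin d),
        ENNReal.ofReal (‖ξ‖ ^ (-α) * ‖-ξ - p‖ ^ (-β)) *
          Φ (2 * Real.pi * (‖ξ‖ ^ 2 + ‖-ξ - p‖ ^ 2), -(ξ + (-ξ - p))) :=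
        lintegral_lintegral_swap (Measurable.aemeasurable (by fun_prop))
    _ ≤ ∫⁻ p : EuclideanSpace ℝ (Fin d), C * ∫⁻ τ, Φ (τ, p) := by
        refine lintegral_mono fun p => ?_
        -- Centring at the midpoint makes the two frequencies `η - p/2` and `-(η + p/2)`. By the
        -- parallelogram law the modulation is then `4π‖η‖² + π‖p‖²`, which is radial in `η`.
        rw [← lintegral_sub_right_eq_self _ ((1 / 2 : ℝ) • p)]
        refine Eq.trans_le (lintegral_congr fun η => ?_)
          (hC ((1 / 2 : ℝ) • p) (Real.pi * ‖p‖ ^ 2) (fun τ => Φ (τ, p)) (by fun_prop))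
        have h1 : -(η - (1 / 2 : ℝ) • p) - p = -(η + (1 / 2 : ℝ) • p) := by module
        have h2 : -(η - (1 / 2 : ℝ) • p + -(η + (1 / 2 : ℝ) • p)) = p := by module
        have h3 := parallelogram_law_with_norm ℝ η ((1 / 2 : ℝ) • p)
        rw [norm_smul, Real.norm_of_nonneg (by norm_num)] at h3
        rw [h1, norm_neg, h2]
        congr 3
        linear_combination 2 * Real.pi * h3
    _ = _ := lintegral_const_mul _ (by fun_prop)

/-! ### The bilinear estimate for free waves. -/

/-- The solution `e^{itΔ} 𝓕⁻¹ h` of the free Schrödinger equation, in terms of the Fourier transform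
`h` of its initial datum. -/
noncomputable def freeWave {d : ℕ} (h : EuclideanSpace ℝ (Fin d) → ℂ) (t : ℝ) (x : EuclideanSpace ℝ (Fin d)) : ℂ :=
  ∫ ξ, Complex.exp ((2 * Real.pi * inner ℝ x ξ - 4 * Real.pi ^ 2 * t * ‖ξ‖ ^ 2 : ℝ) * Complex.I) * h ξ

/-- The weighted `L²` norm `‖ |ξ|^s h ‖_{L²}`. -/
noncomputable def weightedL2 {d : ℕ} (s : ℝ) (h : EuclideanSpace ℝ (Fin d) → ℂ) : ℝ≥0∞ :=
  eLpNorm (fun ξ => ((‖ξ‖ ^ s : ℝ) : ℂ) * h ξ) 2 volume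

theorem weightedL2_eq {d : ℕ} (s : ℝ) (h : EuclideanSpace ℝ (Fin d) → ℂ) :
    weightedL2 s h = (∫⁻ ξ, (ENNReal.ofReal (‖ξ‖ ^ s) * ‖h ξ‖ₑ) ^ (2 : ℝ)) ^ (1 / 2 : ℝ) := by
  rw [weightedL2, eLpNorm_eq_lintegral_rpow_enorm_toReal (by norm_num) (by norm_num)]
  simp only [ENNReal.toReal_ofNat, enorm_mul]
  congr! 6 with ξ
  rw [← ofReal_norm, Complex.norm_real, Real.norm_of_nonneg (by positivity)]

theorem continuous_freeWave {d : ℕ} {h : EuclideanSpace ℝ (Fin d) → ℂ} (hh : Integrable h) :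
    Continuous fun p : ℝ × EuclideanSpace ℝ (Fin d) => freeWave h p.1 p.2 := by
  refine continuous_of_dominated (bound := fun ξ => ‖h ξ‖) (fun p => ?_) (fun p => ?_) hh.norm ?_
  · exact (Continuous.aestronglyMeasurable (by fun_prop)).mul hh.aestronglyMeasurable
  · refine .of_forall fun ξ => ?_
    rw [norm_mul, Complex.norm_exp_ofReal_mul_I, one_mul]
  · refine .of_forall fun ξ => ?_
    fun_prop

theorem norm_freeWave_le {d : ℕ} (h : EuclideanSpace ℝ (Fin d) → ℂ) (t : ℝ)
    (x : EuclideanSpace ℝ (Fin d)) : ‖freeWave h t x‖ ≤ ∫ ξ, ‖h ξ‖ := by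
  refine (norm_integral_le_integral_norm _).trans_eq ?_
  simp only [norm_mul, Complex.norm_exp_ofReal_mul_I, one_mul]

/-- Fubini: the two phases add up to a single spacetime character. The `WithLp 2` product gives
spacetime the inner product in which `𝓕 χ` is taken. -/
theorem integral_schwartz_mul_freeWave {d : ℕ} {h k : EuclideanSpace ℝ (Fin d) → ℂ}
    (hh : Integrable h) (hk : Integrable k)
    (χ : 𝓢(WithLp 2 (ℝ × EuclideanSpace ℝ (Fin d)), ℂ)) :
    ∫ z, χ z * (freeWave h z.fst z.snd * freeWave k z.fst z.snd) =
      ∫ p : EuclideanSpace ℝ (Fin d) × EuclideanSpace ℝ (Fin d), h p.1 * k p.2 *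
        𝓕 χ (WithLp.toLp 2 (2 * Real.pi * (‖p.1‖ ^ 2 + ‖p.2‖ ^ 2), -(p.1 + p.2))) := by
  have hkk : Integrable (fun p : EuclideanSpace ℝ (Fin d) × EuclideanSpace ℝ (Fin d) =>
    h p.1 * k p.2) (volume.prod volume) := hh.mul_prod hk
  have h1 : ∀ z : WithLp 2 (ℝ × EuclideanSpace ℝ (Fin d)),
      χ z * (freeWave h z.fst z.snd * freeWave k z.fst z.snd) =
      ∫ p : EuclideanSpace ℝ (Fin d) × EuclideanSpace ℝ (Fin d),
        Complex.exp ((-2 * Real.pi * inner ℝ z (WithLp.toLp 2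
          (2 * Real.pi * (‖p.1‖ ^ 2 + ‖p.2‖ ^ 2), -(p.1 + p.2))) : ℝ) * Complex.I) *
          (χ z * (h p.1 * k p.2)) := by
    intro z
    rw [freeWave, freeWave, ← integral_prod_mul, ← integral_const_mul]
    congr 1; ext p
    rw [show ((-2 * Real.pi * inner ℝ z (WithLp.toLp 2
          (2 * Real.pi * (‖p.1‖ ^ 2 + ‖p.2‖ ^ 2), -(p.1 + p.2))) : ℝ) : ℂ) =
        ((2 * Real.pi * inner ℝ z.snd p.1 - 4 * Real.pi ^ 2 * z.fst * ‖p.1‖ ^ 2 : ℝ) : ℂ) +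
        ((2 * Real.pi * inner ℝ z.snd p.2 - 4 * Real.pi ^ 2 * z.fst * ‖p.2‖ ^ 2 : ℝ) : ℂ) by
      rw [← Complex.ofReal_add]
      congr 1
      simp only [WithLp.prod_inner_apply, inner_neg_right, inner_add_right, RCLike.inner_apply,
        conj_trivial, WithLp.ofLp_fst, WithLp.ofLp_snd]
      ring, add_mul, Complex.exp_add]
    ring
  have hint : Integrable (fun q : WithLp 2 (ℝ × EuclideanSpace ℝ (Fin d)) ×
      (EuclideanSpace ℝ (Fin d) × EuclideanSpace ℝ (Fin d)) =>
        Complex.exp ((-2 * Real.pi * inner ℝ q.1 (WithLp.toLp 2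
          (2 * Real.pi * (‖q.2.1‖ ^ 2 + ‖q.2.2‖ ^ 2), -(q.2.1 + q.2.2))) : ℝ) * Complex.I) *
          (χ q.1 * (h q.2.1 * k q.2.2))) (volume.prod (volume.prod volume)) := by
    refine (χ.integrable.mul_prod hkk).bdd_mul (c := 1)
      (Continuous.aestronglyMeasurable (by fun_prop)) (.of_forall fun q => ?_)
    rw [Complex.norm_exp_ofReal_mul_I]
  simp_rw [h1]
  rw [Measure.volume_eq_prod (EuclideanSpace ℝ (Fin d)), integral_integral_swap hint]
  congr 1; ext p
  rw [SchwartzMap.fourier_coe, Real.fourier_eq, ← integral_const_mul]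
  congr 1; ext z
  rw [Circle.smul_def, Real.fourierChar_apply, smul_eq_mul]
  push_cast
  ring_nf

/-- Duality with Schwartz functions on spacetime, then Cauchy–Schwarz in the pair of frequencies,
the coarea bound applied to `|𝓕 χ|²`, and Plancherel. The coarea constant enters through its square
root. -/
theorem exists_eLpNorm_freeWave_mul_le {d : ℕ} (hd : 2 ≤ d) {s s' : ℝ} (hs : 2 * s < d - 1)
    (hs' : 2 * s' < d - 1) (hss : 2 * s + 2 * s' = d - 2) :
    ∃ C : ℝ≥0, ∀ h k : EuclideanSpace ℝ (Fin d) → ℂ, Measurable h → Measurable k →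
      Integrable h → Integrable k → weightedL2 s h ≠ ⊤ → weightedL2 s' k ≠ ⊤ →
      eLpNorm (fun p : ℝ × EuclideanSpace ℝ (Fin d) => freeWave h p.1 p.2 * freeWave k p.1 p.2) 2
        volume ≤ C * (weightedL2 s h * weightedL2 s' k) := by
  obtain ⟨C, hC⟩ := exists_lintegral_paraboloid_le hd hs hs' hss
  refine ⟨NNReal.sqrt C, fun h k hhm hkm hh hk hsh hsk => ?_⟩
  have hmp := WithLp.volume_preserving_ofLp ℝ (EuclideanSpace ℝ (Fin d))
  have hcont : Continuous fun p : ℝ × EuclideanSpace ℝ (Fin d) =>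
      freeWave h p.1 p.2 * freeWave k p.1 p.2 := (continuous_freeWave hh).mul (continuous_freeWave hk)
  have hcont' : Continuous fun z : WithLp 2 (ℝ × EuclideanSpace ℝ (Fin d)) =>
      freeWave h z.fst z.snd * freeWave k z.fst z.snd :=
    hcont.comp (WithLp.prod_continuous_ofLp 2 ℝ (EuclideanSpace ℝ (Fin d)))
  rw [← eLpNorm_comp_measurePreserving hcont.aestronglyMeasurable hmp]
  set A : ℝ≥0∞ := NNReal.sqrt C * (weightedL2 s h * weightedL2 s' k) with hA
  have hAtop : A ≠ ⊤ := ENNReal.mul_ne_top ENNReal.coe_ne_top (ENNReal.mul_ne_top hsh hsk)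
  rw [← ENNReal.coe_toNNReal hAtop]
  refine eLpNorm_two_le_of_forall_schwartz hcont'.locallyIntegrable _ (fun χ => ?_) (fun χ => ?_)
  · refine χ.integrable.mul_bdd (c := (∫ ξ, ‖h ξ‖) * ∫ ξ, ‖k ξ‖) hcont'.aestronglyMeasurable
      (.of_forall fun z => ?_)
    rw [norm_mul]
    gcongr
    · exact norm_freeWave_le _ _ _
    · exact norm_freeWave_le _ _ _
  rw [ENNReal.coe_toNNReal hAtop, integral_schwartz_mul_freeWave hh hk]
  set Φ : ℝ × EuclideanSpace ℝ (Fin d) → ℝ≥0∞ := fun q => ‖𝓕 χ (WithLp.toLp 2 q)‖ₑ with hΦ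
  have hΦm : Measurable Φ := Continuous.measurable (by fun_prop)
  have hne : ∀ᵐ p : EuclideanSpace ℝ (Fin d) × EuclideanSpace ℝ (Fin d) ∂(volume.prod volume),
      p.1 ≠ 0 ∧ p.2 ≠ 0 := by
    have : Nontrivial (EuclideanSpace ℝ (Fin d)) := by
      have : Nonempty (Fin d) := ⟨⟨0, by omega⟩⟩
      infer_instance
    exact (Measure.quasiMeasurePreserving_fst.ae (Measure.ae_ne volume 0)).and
      (Measure.quasiMeasurePreserving_snd.ae (Measure.ae_ne volume 0))
  -- The weights placed in `a` and `b` cancel wherever both frequencies are nonzero, hence almost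
  -- everywhere.
  set a : EuclideanSpace ℝ (Fin d) × EuclideanSpace ℝ (Fin d) → ℝ≥0∞ := fun p =>
    (ENNReal.ofReal (‖p.1‖ ^ s) * ‖h p.1‖ₑ) * (ENNReal.ofReal (‖p.2‖ ^ s') * ‖k p.2‖ₑ) with ha
  set b : EuclideanSpace ℝ (Fin d) × EuclideanSpace ℝ (Fin d) → ℝ≥0∞ := fun p =>
    ENNReal.ofReal (‖p.1‖ ^ (-s) * ‖p.2‖ ^ (-s')) *
      Φ (2 * Real.pi * (‖p.1‖ ^ 2 + ‖p.2‖ ^ 2), -(p.1 + p.2)) with hb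
  have ham : Measurable a := by fun_prop
  have hbm : Measurable b := by fun_prop
  calc _ ≤ ∫⁻ p : EuclideanSpace ℝ (Fin d) × EuclideanSpace ℝ (Fin d), ‖h p.1 * k p.2 *
        𝓕 χ (WithLp.toLp 2 (2 * Real.pi * (‖p.1‖ ^ 2 + ‖p.2‖ ^ 2), -(p.1 + p.2)))‖ₑ :=
        enorm_integral_le_lintegral_enorm _
    _ ≤ ∫⁻ p, (a * b) p := by
        refine lintegral_mono_ae ?_
        filter_upwards [hne] with p hp
        have h1 : 0 < ‖p.1‖ := norm_pos_iff.2 hp.1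
        have h2 : 0 < ‖p.2‖ := norm_pos_iff.2 hp.2
        have h3 : ENNReal.ofReal (‖p.1‖ ^ s) * ENNReal.ofReal (‖p.2‖ ^ s') *
            ENNReal.ofReal (‖p.1‖ ^ (-s) * ‖p.2‖ ^ (-s')) = 1 := by
          rw [← ENNReal.ofReal_mul (by positivity), ← ENNReal.ofReal_mul (by positivity),
            Real.rpow_neg h1.le, Real.rpow_neg h2.le]
          field_simp
          simp
        rw [enorm_mul, enorm_mul]
        simp only [Pi.mul_apply, ha, hb, hΦ]
        calc _ = (ENNReal.ofReal (‖p.1‖ ^ s) * ENNReal.ofReal (‖p.2‖ ^ s') *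
            ENNReal.ofReal (‖p.1‖ ^ (-s) * ‖p.2‖ ^ (-s'))) * (‖h p.1‖ₑ * ‖k p.2‖ₑ *
              ‖𝓕 χ (WithLp.toLp 2 (2 * Real.pi * (‖p.1‖ ^ 2 + ‖p.2‖ ^ 2), -(p.1 + p.2)))‖ₑ) := by
              rw [h3, one_mul]
          _ ≤ _ := le_of_eq (by ring)
    _ ≤ (∫⁻ p, a p ^ (2 : ℝ)) ^ (1 / 2 : ℝ) * (∫⁻ p, b p ^ (2 : ℝ)) ^ (1 / 2 : ℝ) :=
        ENNReal.lintegral_mul_le_Lp_mul_Lq _ Real.HolderConjugate.two_two ham.aemeasurable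
          hbm.aemeasurable
    _ ≤ (weightedL2 s h * weightedL2 s' k) * (C * ∫⁻ z, Φ z ^ (2 : ℝ)) ^ (1 / 2 : ℝ) := by
        gcongr ?_ * ?_ ^ (1 / 2 : ℝ)
        · rw [weightedL2_eq, weightedL2_eq, ← ENNReal.mul_rpow_of_nonneg _ _ (by norm_num)]
          refine le_of_eq ?_
          congr 1
          rw [← lintegral_prod_mul (by fun_prop) (by fun_prop)]
          simp only [ha, ENNReal.mul_rpow_of_nonneg _ _ (zero_le_two : (0 : ℝ) ≤ 2)]
          rfl
        · refine Eq.trans_le ?_ (hC (fun z => Φ z ^ (2 : ℝ)) (by fun_prop))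
          refine lintegral_congr fun p => ?_
          simp only [hb, ENNReal.mul_rpow_of_nonneg _ _ (zero_le_two : (0 : ℝ) ≤ 2)]
          congr 1
          rw [ENNReal.ofReal_rpow_of_nonneg (by positivity) (by norm_num),
            Real.mul_rpow (by positivity) (by positivity), ← Real.rpow_mul (by positivity),
            ← Real.rpow_mul (by positivity)]
          ring_nf
    _ = A * eLpNorm χ 2 volume := by
        have h1 : ∫⁻ z, Φ z ^ (2 : ℝ) =
            ∫⁻ z : WithLp 2 (ℝ × EuclideanSpace ℝ (Fin d)), ‖𝓕 χ z‖ₑ ^ (2 : ℝ) :=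
          (hmp.lintegral_comp (f := fun z => Φ z ^ (2 : ℝ)) (by fun_prop)).symm
        have h2 : eLpNorm χ 2 volume = eLpNorm (𝓕 χ : 𝓢(WithLp 2 (ℝ × EuclideanSpace ℝ (Fin d)), ℂ)) 2 volume := by
          have := SchwartzMap.norm_fourier_toL2_eq χ
          rw [SchwartzMap.norm_toLp, SchwartzMap.norm_toLp,
            ENNReal.toReal_eq_toReal_iff' (SchwartzMap.memLp _ _ _).2.ne (SchwartzMap.memLp _ _ _).2.ne] at this
          exact this.symm
        rw [h1, h2, eLpNorm_eq_lintegral_rpow_enorm_toReal (p := 2) (by norm_num) (by norm_num),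
          ENNReal.toReal_ofNat, ENNReal.mul_rpow_of_nonneg _ _ (by norm_num), hA,
          NNReal.sqrt_eq_rpow, ENNReal.coe_rpow_of_nonneg _ (by norm_num)]
        ring

/-! ### Uniform boundedness for tempered distributions. -/

section SumOfBounded

variable {V : Type*} [NormedAddCommGroup V] [NormedSpace ℝ V] {φ : ℕ → 𝓢(V, ℂ)} {B : ℕ → ℕ → ℝ}

theorem SchwartzMap.pow_mul_norm_iteratedFDeriv_smul_le
    (hφ : ∀ k n i, SchwartzMap.seminorm ℝ k n (φ i) ≤ B k n) (a : ℕ → ℂ) (k n i : ℕ) (x : V) :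
    ‖x‖ ^ k * ‖iteratedFDeriv ℝ n (fun y => a i • φ i y) x‖ ≤ ‖a i‖ * B k n := by
  have h1 : iteratedFDeriv ℝ n (fun y => a i • φ i y) x = a i • iteratedFDeriv ℝ n (φ i) x :=
    iteratedFDeriv_const_smul_apply' ((φ i).smooth n).contDiffAt
  rw [h1, norm_smul, mul_left_comm]
  gcongr
  exact ((φ i).le_seminorm ℝ k n x).trans (hφ k n i)

theorem SchwartzMap.norm_iteratedFDeriv_smul_le
    (hφ : ∀ k n i, SchwartzMap.seminorm ℝ k n (φ i) ≤ B k n) (a : ℕ → ℂ) (n i : ℕ) (x : V) :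
    ‖iteratedFDeriv ℝ n (fun y => a i • φ i y) x‖ ≤ ‖a i‖ * B 0 n := by
  simpa using pow_mul_norm_iteratedFDeriv_smul_le hφ a 0 n i x

theorem SchwartzMap.pow_mul_norm_iteratedFDeriv_tsum_le
    (hφ : ∀ k n i, SchwartzMap.seminorm ℝ k n (φ i) ≤ B k n) {a : ℕ → ℂ}
    (ha : Summable fun i => ‖a i‖) (k n : ℕ) (x : V) :
    ‖x‖ ^ k * ‖iteratedFDeriv ℝ n (fun y => ∑' i, a i • φ i y) x‖ ≤ (∑' i, ‖a i‖) * B k n := by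
  rw [iteratedFDeriv_tsum_apply (N := ⊤) (fun i => ((φ i).smooth ⊤).const_smul (a i))
    (fun n _ => ha.mul_right (B 0 n)) (fun n i x _ => norm_iteratedFDeriv_smul_le hφ a n i x) le_top]
  have hs : Summable fun i => ‖iteratedFDeriv ℝ n (fun y => a i • φ i y) x‖ :=
    .of_nonneg_of_le (fun _ => norm_nonneg _) (fun i => norm_iteratedFDeriv_smul_le hφ a n i x)
      (ha.mul_right _)
  calc _ ≤ ‖x‖ ^ k * ∑' i, ‖iteratedFDeriv ℝ n (fun y => a i • φ i y) x‖ := by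
        gcongr; exact norm_tsum_le_tsum_norm hs
    _ = ∑' i, ‖x‖ ^ k * ‖iteratedFDeriv ℝ n (fun y => a i • φ i y) x‖ := tsum_mul_left.symm
    _ ≤ ∑' i, ‖a i‖ * B k n := (hs.mul_left _).tsum_le_tsum
        (fun i => pow_mul_norm_iteratedFDeriv_smul_le hφ a k n i x) (ha.mul_right _)
    _ = _ := tsum_mul_right

theorem summable_norm_lp_one (a : lp (fun _ : ℕ => ℂ) 1) : Summable fun i => ‖a i‖ := by
  simpa using (lp.memℓp a).summable (by norm_num)

/-- The sum of a bounded sequence of Schwartz functions with summable coefficients. -/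
noncomputable def SchwartzMap.sumOfBounded
    (hφ : ∀ k n i, SchwartzMap.seminorm ℝ k n (φ i) ≤ B k n) :
    lp (fun _ : ℕ => ℂ) 1 →ₗ[ℝ] 𝓢(V, ℂ) where
  toFun a :=
    { toFun := fun x => ∑' i, a i • φ i x
      smooth' := contDiff_tsum (fun i => ((φ i).smooth ⊤).const_smul (a i))
        (fun n _ => (summable_norm_lp_one a).mul_right (B 0 n))
        (fun n i x _ => norm_iteratedFDeriv_smul_le hφ a n i x)
      decay' := fun k n =>
        ⟨_, pow_mul_norm_iteratedFDeriv_tsum_le hφ (summable_norm_lp_one a) k n⟩ }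
  map_add' a b := by
    ext x
    have h : ∀ a : lp (fun _ : ℕ => ℂ) 1, Summable fun i => a i • φ i x := fun a =>
      .of_norm_bounded ((summable_norm_lp_one a).mul_right _)
        (fun i => by simpa using norm_iteratedFDeriv_smul_le hφ a 0 i x)
    change ∑' i, (a + b) i • φ i x = ∑' i, a i • φ i x + ∑' i, b i • φ i x
    rw [← (h a).tsum_add (h b)]
    simp [add_mul]
  map_smul' c a := by
    ext x
    change ∑' i, (c • a) i • φ i x = c • ∑' i, a i • φ i x
    rw [← tsum_const_smul'']
    simp [mul_assoc]

theorem SchwartzMap.sumOfBounded_single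
    (hφ : ∀ k n i, SchwartzMap.seminorm ℝ k n (φ i) ≤ B k n) (i : ℕ) :
    SchwartzMap.sumOfBounded hφ (lp.single 1 i 1) = φ i := by
  ext x
  change ∑' j, (lp.single (E := fun _ : ℕ => ℂ) 1 i 1) j • φ j x = φ i x
  rw [tsum_eq_single i]
  · simp
  · intro j hj
    simp [hj]

theorem SchwartzMap.continuous_sumOfBounded
    (hφ : ∀ k n i, SchwartzMap.seminorm ℝ k n (φ i) ≤ B k n) :
    Continuous (SchwartzMap.sumOfBounded hφ) := by
  refine WithSeminorms.continuous_normedSpace_dom (𝕝 := ℝ) _ (schwartz_withSeminorms ℝ V ℂ) _ fun m => ?_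
  have hB : 0 ≤ B m.1 m.2 := (apply_nonneg _ _).trans (hφ m.1 m.2 0)
  refine ⟨(B m.1 m.2).toNNReal, fun a => ?_⟩
  have ha : ‖a‖ = ∑' i, ‖a i‖ := by
    rw [lp.norm_eq_tsum_rpow (by norm_num)]; simp
  refine SchwartzMap.seminorm_le_bound ℝ m.1 m.2 _ (by positivity) fun x => ?_
  refine (pow_mul_norm_iteratedFDeriv_tsum_le hφ (summable_norm_lp_one a) m.1 m.2 x).trans_eq ?_
  change _ = (B m.1 m.2).toNNReal * ‖a‖
  rw [ha, Real.coe_toNNReal _ hB, mul_comm]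

/-- Uniform boundedness for tempered distributions: a pointwise bounded family is uniformly bounded
on bounded sequences of Schwartz functions. -/
theorem TemperedDistribution.exists_bound_of_pointwise_bounded
    (hφ : ∀ k n i, SchwartzMap.seminorm ℝ k n (φ i) ≤ B k n) {ι : Type*} {w : ι → 𝓢'(V, ℂ)}
    (hw : ∀ f, ∃ C, ∀ i, ‖w i f‖ ≤ C) : ∃ C, ∀ i n, ‖w i (φ n)‖ ≤ C := by
  -- Superposing the `φ n` with summable coefficients maps `ℓ¹` continuously into the Schwartz
  -- space. Composition turns the distributions into functionals on a Banach space, where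
  -- Banach–Steinhaus applies; the unit vectors recover the values at `φ n`.
  let g : ι → lp (fun _ : ℕ => ℂ) 1 →L[ℝ] ℂ := fun i =>
    { toFun := fun a => w i (SchwartzMap.sumOfBounded hφ a)
      map_add' := fun a b => by simp
      map_smul' := fun c a => by
        rw [map_smul]
        exact (w i).toLinearMap.map_smul_of_tower c _
      cont := (ContinuousLinearMap.continuous (w i : 𝓢(V, ℂ) →L[ℂ] ℂ)).comp (SchwartzMap.continuous_sumOfBounded hφ) }
  obtain ⟨C, hC⟩ := banach_steinhaus (g := g) fun a => hw _
  refine ⟨C, fun i n => ?_⟩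
  have h1 : g i (lp.single 1 n 1) = w i (φ n) := by
    change w i (SchwartzMap.sumOfBounded hφ (lp.single 1 n 1)) = _
    rw [SchwartzMap.sumOfBounded_single]
  rw [← h1]
  refine ((g i).le_opNorm _).trans ?_
  rw [lp.norm_single (by norm_num), norm_one, mul_one]
  exact hC i

end SumOfBounded

/-! ### Multiplication operators and cut-offs on Schwartz functions. -/

section Multiplication

variable {V : Type*} [NormedAddCommGroup V] [NormedSpace ℝ V]

theorem ContDiff.exists_bound_iteratedFDeriv {q : V → ℂ} (hq : ContDiff ℝ (⊤ : ℕ∞) q)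
    (hqc : HasCompactSupport q) : ∃ C : ℕ → ℝ, ∀ n x, ‖iteratedFDeriv ℝ n q x‖ ≤ C n := by
  have h : ∀ n, ∃ C, ∀ x, ‖iteratedFDeriv ℝ n q x‖ ≤ C := fun n =>
    (hq.continuous_iteratedFDeriv (m := n)
      (by exact_mod_cast le_top)).bounded_above_of_compact_support (hqc.iteratedFDeriv n)
  choose C hC using h
  exact ⟨C, hC⟩

theorem SchwartzMap.pow_mul_norm_iteratedFDeriv_mul_le {q : V → ℂ} (hq : ContDiff ℝ (⊤ : ℕ∞) q)
    {C : ℕ → ℝ} (hC : ∀ n x, ‖iteratedFDeriv ℝ n q x‖ ≤ C n) (f : 𝓢(V, ℂ)) (k m : ℕ) (x : V) :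
    ‖x‖ ^ k * ‖iteratedFDeriv ℝ m (fun y => q y * f y) x‖ ≤
      ∑ i ∈ Finset.range (m + 1), m.choose i * C i * (‖x‖ ^ k * ‖iteratedFDeriv ℝ (m - i) f x‖) := by
  calc _ ≤ ‖x‖ ^ k * ∑ i ∈ Finset.range (m + 1), (m.choose i : ℝ) * ‖iteratedFDeriv ℝ i q x‖ *
        ‖iteratedFDeriv ℝ (m - i) f x‖ := by
        gcongr
        exact norm_iteratedFDeriv_mul_le (N := (⊤ : ℕ∞)) hq (f.smooth ⊤) x (by exact_mod_cast le_top)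
    _ ≤ ‖x‖ ^ k * ∑ i ∈ Finset.range (m + 1), (m.choose i : ℝ) * C i *
        ‖iteratedFDeriv ℝ (m - i) f x‖ := by
        gcongr with i hi
        exact hC i x
    _ = _ := by
        rw [Finset.mul_sum]
        exact Finset.sum_congr rfl fun i _ => by ring

/-- Summing over all derivative orders up to `m` gives a quantity that the Leibniz rule bounds by a
multiple of itself, so the estimate can be iterated with a constant `K ^ n`. -/
theorem SchwartzMap.seminorm_smulLeftCLM_le {q : V → ℂ} (hq : ContDiff ℝ (⊤ : ℕ∞) q)
    (hq' : q.HasTemperateGrowth)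
    {C : ℕ → ℝ} (hC : ∀ n x, ‖iteratedFDeriv ℝ n q x‖ ≤ C n) (k m : ℕ) :
    ∃ K : ℝ, 0 ≤ K ∧ ∀ f : 𝓢(V, ℂ), ∑ j ∈ Finset.range (m + 1),
      SchwartzMap.seminorm ℝ k j (SchwartzMap.smulLeftCLM ℂ q f) ≤
        K * ∑ j ∈ Finset.range (m + 1), SchwartzMap.seminorm ℝ k j f := by
  have hC0 : ∀ n, 0 ≤ C n := fun n => (norm_nonneg _).trans (hC n 0)
  refine ⟨∑ j ∈ Finset.range (m + 1), ∑ i ∈ Finset.range (j + 1), j.choose i * C i,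
    Finset.sum_nonneg fun j _ => Finset.sum_nonneg fun i _ => mul_nonneg (by positivity) (hC0 i),
    fun f => ?_⟩
  rw [Finset.sum_mul]
  refine Finset.sum_le_sum fun j hj => ?_
  have hj' : j ≤ m := Nat.lt_succ_iff.1 (Finset.mem_range.1 hj)
  have hS : ∀ i ≤ m, SchwartzMap.seminorm ℝ k i f ≤
      ∑ j ∈ Finset.range (m + 1), SchwartzMap.seminorm ℝ k j f := fun i hi =>
    Finset.single_le_sum (f := fun j => SchwartzMap.seminorm ℝ k j f) (fun _ _ => apply_nonneg _ _)
      (Finset.mem_range.2 (Nat.lt_succ_iff.2 hi))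
  refine SchwartzMap.seminorm_le_bound ℝ k j _ (mul_nonneg (Finset.sum_nonneg fun i _ =>
    mul_nonneg (by positivity) (hC0 i)) ((apply_nonneg _ _).trans (hS 0 (Nat.zero_le _)))) fun x => ?_
  rw [SchwartzMap.smulLeftCLM_apply hq']
  refine (pow_mul_norm_iteratedFDeriv_mul_le hq hC f k j x).trans ?_
  rw [Finset.sum_mul]
  refine Finset.sum_le_sum fun i _ => ?_
  refine mul_le_mul_of_nonneg_left ?_ (mul_nonneg (by positivity) (hC0 i))
  exact (f.le_seminorm ℝ k (j - i) x).trans (hS _ ((Nat.sub_le _ _).trans hj'))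

theorem SchwartzMap.seminorm_iterate_smulLeftCLM_le {q : V → ℂ} (hq : ContDiff ℝ (⊤ : ℕ∞) q)
    (hqc : HasCompactSupport q) (k m : ℕ) :
    ∃ K : ℝ, 0 ≤ K ∧ ∀ f : 𝓢(V, ℂ), ∃ A, 0 ≤ A ∧ ∀ n : ℕ,
      SchwartzMap.seminorm ℝ k m ((SchwartzMap.smulLeftCLM ℂ q)^[n] f) ≤ K ^ n * A := by
  obtain ⟨C, hC⟩ := hq.exists_bound_iteratedFDeriv hqc
  obtain ⟨K, hK, h⟩ := seminorm_smulLeftCLM_le hq (hqc.hasTemperateGrowth hq) hC k m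
  refine ⟨K, hK, fun f => ⟨∑ j ∈ Finset.range (m + 1), SchwartzMap.seminorm ℝ k j f,
    Finset.sum_nonneg fun _ _ => apply_nonneg _ _, fun n => ?_⟩⟩
  have hn : ∑ j ∈ Finset.range (m + 1),
      SchwartzMap.seminorm ℝ k j ((SchwartzMap.smulLeftCLM ℂ q)^[n] f) ≤
        K ^ n * ∑ j ∈ Finset.range (m + 1), SchwartzMap.seminorm ℝ k j f := by
    induction n with
    | zero => simp
    | succ n ih =>
      rw [Function.iterate_succ_apply', pow_succ']
      refine (h _).trans ?_
      rw [mul_assoc]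
      gcongr
  exact (Finset.single_le_sum (f := fun j => SchwartzMap.seminorm ℝ k j
    ((SchwartzMap.smulLeftCLM ℂ q)^[n] f)) (fun _ _ => apply_nonneg _ _)
    (Finset.mem_range.2 (Nat.lt_succ_self m))).trans hn

end Multiplication

section NormSq

variable {V : Type*} [NormedAddCommGroup V] [InnerProductSpace ℝ V]

/-- Multiplication of Schwartz functions by `|x|²`. -/
noncomputable def SchwartzMap.normSqMul : 𝓢(V, ℂ) →L[ℂ] 𝓢(V, ℂ) :=
  SchwartzMap.smulLeftCLM ℂ fun x => ((‖x‖ ^ 2 : ℝ) : ℂ)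

theorem SchwartzMap.normSqMul_apply (f : 𝓢(V, ℂ)) (x : V) :
    SchwartzMap.normSqMul f x = ((‖x‖ ^ 2 : ℝ) : ℂ) * f x := by
  rw [normSqMul, smulLeftCLM_apply_apply (by fun_prop), smul_eq_mul]

theorem SchwartzMap.iterate_normSqMul_apply (f : 𝓢(V, ℂ)) (n : ℕ) (x : V) :
    (SchwartzMap.normSqMul^[n] f) x = ((‖x‖ ^ 2 : ℝ) : ℂ) ^ n * f x := by
  induction n with
  | zero => simp
  | succ n ih => rw [Function.iterate_succ_apply', normSqMul_apply, ih]; ring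

variable [FiniteDimensional ℝ V]

/-- On the support of `f`, multiplication by `|x|²` agrees with multiplication by a smooth compactly
supported `q`. Its iterates grow at most geometrically in each seminorm, and the factorial beats
this: `(cK)^n / n! ≤ exp (cK)`. -/
theorem SchwartzMap.exists_seminorm_iterate_normSqMul_le {f : 𝓢(V, ℂ)} (hf : HasCompactSupport f)
    (c : ℝ) (hc : 0 ≤ c) : ∃ B : ℕ → ℕ → ℝ, ∀ k m n, SchwartzMap.seminorm ℝ k m
      (((c ^ n / n.factorial : ℝ) : ℂ) • SchwartzMap.normSqMul^[n] f) ≤ B k m := by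
  obtain ⟨R, hR, hfR⟩ := hf.isCompact.isBounded.exists_pos_norm_le
  let b : ContDiffBump (0 : V) := ⟨R, R + 1, hR, by linarith⟩
  set q : V → ℂ := fun x => ((‖x‖ ^ 2 : ℝ) : ℂ) * ((b x : ℝ) : ℂ) with hq
  have hqs : ContDiff ℝ (⊤ : ℕ∞) q := by
    refine ContDiff.mul ?_ (Complex.ofRealCLM.contDiff.comp b.contDiff)
    exact Complex.ofRealCLM.contDiff.comp (contDiff_norm_sq ℝ)
  have hqc : HasCompactSupport q := (b.hasCompactSupport.comp_left (g := Complex.ofReal) rfl).mul_left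
  have hiter : ∀ n, SchwartzMap.normSqMul^[n] f = (SchwartzMap.smulLeftCLM ℂ q)^[n] f := by
    intro n
    have h : ∀ x, ((SchwartzMap.smulLeftCLM ℂ q)^[n] f) x = q x ^ n * f x := by
      intro x
      induction n with
      | zero => simp
      | succ n ih =>
        rw [Function.iterate_succ_apply',
          SchwartzMap.smulLeftCLM_apply_apply (hqc.hasTemperateGrowth hqs), ih, smul_eq_mul]
        ring
    ext x
    rw [h, iterate_normSqMul_apply]
    by_cases hx : x ∈ tsupport f
    · have : b x = 1 := b.one_of_mem_closedBall (by simpa [b] using hfR x hx)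
      simp [hq, this]
    · simp [image_eq_zero_of_notMem_tsupport hx]
  have key : ∀ k m, ∃ B, ∀ n : ℕ, SchwartzMap.seminorm ℝ k m
      (((c ^ n / n.factorial : ℝ) : ℂ) • SchwartzMap.normSqMul^[n] f) ≤ B := by
    intro k m
    obtain ⟨K, hK, h⟩ := seminorm_iterate_smulLeftCLM_le hqs hqc k m
    obtain ⟨A, hA, h⟩ := h f
    refine ⟨Real.exp (c * K) * A, fun n => ?_⟩
    have h1 : SchwartzMap.seminorm ℝ k m
        (((c ^ n / n.factorial : ℝ) : ℂ) • SchwartzMap.normSqMul^[n] f) =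
        (c ^ n / n.factorial) * SchwartzMap.seminorm ℝ k m (SchwartzMap.normSqMul^[n] f) := by
      rw [show ((c ^ n / n.factorial : ℝ) : ℂ) • SchwartzMap.normSqMul^[n] f =
        (c ^ n / n.factorial : ℝ) • SchwartzMap.normSqMul^[n] f by ext x; simp, map_smul_eq_mul,
        Real.norm_of_nonneg (by positivity)]
    rw [h1, hiter]
    calc _ ≤ (c ^ n / n.factorial) * (K ^ n * A) := by gcongr; exact h n
      _ = (c * K) ^ n / n.factorial * A := by rw [mul_pow]; ring
      _ ≤ _ := by
          gcongr
          exact Real.pow_div_factorial_le_exp _ (by positivity) n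
  choose B hB using key
  exact ⟨B, hB⟩

/-- Compactly supported Schwartz functions are dense; the approximants may be chosen dominated by
the limit. -/
theorem SchwartzMap.exists_seq_hasCompactSupport_tendsto (f : 𝓢(V, ℂ)) :
    ∃ g : ℕ → 𝓢(V, ℂ), (∀ j, HasCompactSupport (g j)) ∧ (∀ j x, ‖g j x‖ ≤ ‖f x‖) ∧
      (∀ x, Filter.Tendsto (fun j => g j x) Filter.atTop (nhds (f x))) ∧
      Filter.Tendsto g Filter.atTop (nhds f) := by
  let b : ContDiffBump (0 : V) := ⟨1, 2, one_pos, by norm_num⟩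
  set q : ℕ → V → ℂ := fun j x => ((b ((1 / (j + 1 : ℝ)) • x) : ℝ) : ℂ) with hq
  have hqs : ∀ j, ContDiff ℝ (⊤ : ℕ∞) (q j) := fun j =>
    Complex.ofRealCLM.contDiff.comp (b.contDiff.comp (contDiff_const_smul _))
  have hqc : ∀ j, HasCompactSupport (q j) := fun j =>
    (b.hasCompactSupport.comp_left (g := Complex.ofReal) rfl).comp_smul (by positivity)
  have hq1 : ∀ (j : ℕ) (x : V), ‖x‖ ≤ j + 1 → q j x = 1 := by
    intro j x hx
    have : b ((1 / (j + 1 : ℝ)) • x) = 1 := b.one_of_mem_closedBall (by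
      rw [mem_closedBall_zero_iff, norm_smul, Real.norm_of_nonneg (by positivity), one_div,
        inv_mul_le_iff₀ (by positivity), mul_one]
      exact hx)
    simp only [hq, this, Complex.ofReal_one]
  refine ⟨fun j => smulLeftCLM ℂ (q j) f, fun j => ?_, fun j x => ?_, fun x => ?_, ?_⟩
  · rw [smulLeftCLM_apply ((hqc j).hasTemperateGrowth (hqs j))]
    exact (hqc j).smul_right
  · rw [smulLeftCLM_apply_apply ((hqc j).hasTemperateGrowth (hqs j)), norm_smul]
    refine mul_le_of_le_one_left (norm_nonneg _) ?_
    rw [hq, Complex.norm_real, Real.norm_of_nonneg b.nonneg]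
    exact b.le_one
  · refine tendsto_const_nhds.congr' ?_
    obtain ⟨N, hN⟩ := exists_nat_ge ‖x‖
    filter_upwards [Filter.eventually_ge_atTop N] with j hj
    rw [smulLeftCLM_apply_apply ((hqc j).hasTemperateGrowth (hqs j)), hq1 j x, one_smul]
    have : (N : ℝ) ≤ j := by exact_mod_cast hj
    linarith
  -- The error is `θ(x/(j+1)) f(x)`, which vanishes for `|x| < j + 1`. Spending one more power of
  -- `|x|` on the decay of `f` gains the factor `1/(j + 1)`.
  · set θ : V → ℂ := fun x => ((b x : ℝ) : ℂ) - 1 with hθ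
    have hθs : ContDiff ℝ (⊤ : ℕ∞) θ :=
      (Complex.ofRealCLM.contDiff.comp b.contDiff).sub contDiff_const
    have hθb : ∃ C : ℕ → ℝ, ∀ n x, ‖iteratedFDeriv ℝ n θ x‖ ≤ C n := by
      obtain ⟨C, hC⟩ := ContDiff.exists_bound_iteratedFDeriv (q := fun x => ((b x : ℝ) : ℂ))
        (Complex.ofRealCLM.contDiff.comp b.contDiff)
        (b.hasCompactSupport.comp_left (g := Complex.ofReal) rfl)
      refine ⟨fun n => C n + 1, fun n x => ?_⟩
      obtain rfl | hn := Nat.eq_zero_or_pos n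
      · have := hC 0 x
        rw [norm_iteratedFDeriv_zero] at this ⊢
        refine (norm_sub_le _ _).trans ?_
        rw [norm_one]; linarith
      · have h1 : iteratedFDeriv ℝ n θ x = iteratedFDeriv ℝ n (fun x => ((b x : ℝ) : ℂ)) x := by
          have h2 : θ = (fun x => ((b x : ℝ) : ℂ)) - fun _ => 1 := rfl
          have h3 : ContDiff ℝ n fun x => ((b x : ℝ) : ℂ) := Complex.ofRealCLM.contDiff.comp b.contDiff
          rw [h2, iteratedFDeriv_sub h3 contDiff_const, Pi.sub_apply,
            iteratedFDeriv_const_of_ne hn.ne', Pi.zero_apply, sub_zero]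
        rw [h1]
        linarith [hC n x]
    obtain ⟨C, hC⟩ := hθb
    have hC0 : ∀ n, 0 ≤ C n := fun n => (norm_nonneg _).trans (hC n 0)
    have hθj : ∀ (j : ℕ) n x, ‖iteratedFDeriv ℝ n (fun y => θ ((1 / (j + 1 : ℝ)) • y)) x‖ ≤ C n := by
      intro j n x
      rw [iteratedFDeriv_comp_const_smul _ (hθs.of_le (by exact_mod_cast le_top)), norm_smul]
      refine (mul_le_of_le_one_left (norm_nonneg _) ?_).trans (hC n _)
      rw [norm_pow]
      refine pow_le_one₀ (norm_nonneg _) ?_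
      rw [Real.norm_of_nonneg (by positivity), div_le_one (by positivity)]
      linarith [Nat.cast_nonneg (α := ℝ) j]
    rw [(schwartz_withSeminorms ℝ V ℂ).tendsto_nhds _ _]
    intro m ε hε
    set K : ℝ := ∑ i ∈ Finset.range (m.2 + 1), m.2.choose i * C i *
      SchwartzMap.seminorm ℝ (m.1 + 1) (m.2 - i) f with hK
    have hK0 : 0 ≤ K := Finset.sum_nonneg fun i _ => mul_nonneg (mul_nonneg (by positivity) (hC0 i))
      (apply_nonneg _ _)
    have hbound : ∀ j : ℕ, SchwartzMap.seminorm ℝ m.1 m.2 (smulLeftCLM ℂ (q j) f - f) ≤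
        K / (j + 1) := by
      intro j
      refine SchwartzMap.seminorm_le_bound ℝ _ _ _ (by positivity) fun x => ?_
      have hfun : ⇑(smulLeftCLM ℂ (q j) f - f) = fun y => θ ((1 / (j + 1 : ℝ)) • y) * f y := by
        ext y
        rw [_root_.sub_apply, smulLeftCLM_apply_apply ((hqc j).hasTemperateGrowth (hqs j))]
        simp only [hθ, hq, smul_eq_mul]
        ring
      obtain hx | hx := lt_or_ge ‖x‖ (j + 1)
      · have h0 : (fun y => θ ((1 / (j + 1 : ℝ)) • y) * f y) =ᶠ[nhds x] fun _ => 0 := by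
          filter_upwards [(isOpen_lt continuous_norm continuous_const).mem_nhds hx] with y hy
          have := hq1 j y (le_of_lt hy)
          simp only [hq] at this
          simp only [hθ, this]
          ring
        rw [hfun, (h0.iteratedFDeriv ℝ m.2).eq_of_nhds]
        simp only [iteratedFDeriv_fun_zero, Pi.zero_apply, norm_zero, mul_zero]
        positivity
      · rw [hfun, le_div_iff₀ (by positivity), hK]
        refine (mul_le_mul_of_nonneg_right (pow_mul_norm_iteratedFDeriv_mul_le
          (hθs.comp (contDiff_const_smul _)) (hθj j) f m.1 m.2 x) (by positivity)).trans ?_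
        rw [Finset.sum_mul]
        refine Finset.sum_le_sum fun i _ => ?_
        rw [mul_assoc]
        refine mul_le_mul_of_nonneg_left ?_ (mul_nonneg (by positivity) (hC0 i))
        refine le_trans ?_ (f.le_seminorm ℝ (m.1 + 1) (m.2 - i) x)
        rw [pow_succ, mul_right_comm]
        gcongr
    have hlim : Filter.Tendsto (fun j : ℕ => K / ((j : ℝ) + 1)) Filter.atTop (nhds 0) :=
      tendsto_const_nhds.div_atTop (Filter.tendsto_atTop_add_const_right _ _ tendsto_natCast_atTop_atTop)
    filter_upwards [hlim.eventually_lt_const hε] with j hj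
    exact (hbound j).trans_lt hj

end NormSq

/-! ### Duhamel's formula for distribution-valued solutions. -/

theorem TemperedDistribution.fourier_laplacian_apply {V : Type*} [NormedAddCommGroup V]
    [InnerProductSpace ℝ V] [FiniteDimensional ℝ V] [MeasurableSpace V] [BorelSpace V]
    (u : 𝓢'(V, ℂ)) (f : 𝓢(V, ℂ)) :
    (Δ u) (𝓕 f) = -((4 * Real.pi ^ 2 : ℝ) : ℂ) * (𝓕 u) (SchwartzMap.normSqMul f) := by
  rw [TemperedDistribution.laplacian_eq_fourierMultiplierCLM,
    TemperedDistribution.fourierMultiplierCLM_apply]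
  change (-(2 * Real.pi) ^ 2 : ℝ) • ((TemperedDistribution.smulLeftCLM ℂ
    (fun x ↦ Complex.ofReal (‖x‖ ^ 2)) (𝓕 u)) (𝓕⁻ (𝓕 f))) = _
  rw [FourierTransform.fourierInv_fourier_eq]
  change (-(2 * Real.pi) ^ 2 : ℝ) • ((𝓕 u) (SchwartzMap.normSqMul f)) = _
  rw [Complex.real_smul]
  push_cast
  ring

open Set in
theorem IntervalIntegrable.exists_absolutelyContinuous_primitive {q : ℝ → ℂ} {x y : ℝ}
    (hq : IntervalIntegrable q volume x y) :
    ∃ Q : ℝ → ℂ, AbsolutelyContinuousOnInterval Q x y ∧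
      (∀ t ∈ uIcc x y, Q t = ∫ s in x..t, q s) ∧ ∀ᵐ t, t ∈ uIcc x y → HasDerivAt Q (q t) t := by
  have hre : IntervalIntegrable (fun t => (q t).re) volume x y := ⟨hq.1.re, hq.2.re⟩
  have him : IntervalIntegrable (fun t => (q t).im) volume x y := ⟨hq.1.im, hq.2.im⟩
  have hc : ∀ c : ℂ, AbsolutelyContinuousOnInterval (fun _ : ℝ => c) x y := fun c =>
    ((LipschitzWith.const c).lipschitzOnWith (s := uIcc x y)).absolutelyContinuousOnInterval
  refine ⟨fun t => (∫ s in x..t, (q s).re) • (1 : ℂ) + (∫ s in x..t, (q s).im) • Complex.I,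
    ((hre.absolutelyContinuousOnInterval_intervalIntegral left_mem_uIcc).fun_smul
    (hc 1)).fun_add ((him.absolutelyContinuousOnInterval_intervalIntegral left_mem_uIcc).fun_smul
    (hc Complex.I)), fun t ht => ?_, ?_⟩
  · have hqt : IntervalIntegrable q volume x t := hq.mono_set (uIcc_subset_uIcc_left ht)
    apply Complex.ext
    · simpa using Complex.reCLM.intervalIntegral_comp_comm hqt
    · simpa using Complex.imCLM.intervalIntegral_comp_comm hqt
  · filter_upwards [hre.ae_hasDerivAt_integral, him.ae_hasDerivAt_integral] with t h1 h2 ht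
    refine (((h1 ht x left_mem_uIcc).smul_const (1 : ℂ)).add
      ((h2 ht x left_mem_uIcc).smul_const Complex.I)).congr_deriv ?_
    simp [Complex.re_add_im]

open Set in
/-- Product rule, in integrated form, for a `C¹` function and a primitive of an integrable one. -/
theorem mul_sub_mul_eq_integral_of_primitive {p p' a q : ℝ → ℂ} {x y : ℝ}
    (hp : ∀ t, HasDerivAt p (p' t) t) (hp' : Continuous p')
    (hq : IntervalIntegrable q volume x y) (ha : ∀ t ∈ uIcc x y, a t - a x = ∫ s in x..t, q s) :
    p y * a y - p x * a x = ∫ t in x..y, (p' t * a t + p t * q t) := by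
  obtain ⟨Q, hQac, hQ, hQd⟩ := hq.exists_absolutelyContinuous_primitive
  have haQ : ∀ t ∈ uIcc x y, a t = a x + Q t := fun t ht => by
    rw [hQ t ht]
    exact sub_eq_iff_eq_add'.1 (ha t ht)
  have hpc : Continuous p := continuous_iff_continuousAt.2 fun t => (hp t).continuousAt
  have hbac : AbsolutelyContinuousOnInterval (fun t => a x + Q t) x y :=
    ((LipschitzWith.const (a x)).lipschitzOnWith.absolutelyContinuousOnInterval).fun_add hQac
  have hpac : AbsolutelyContinuousOnInterval p x y := by
    refine ContDiffOn.absolutelyContinuousOnInterval (ContDiff.contDiffOn ?_)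
    rw [contDiff_one_iff_deriv]
    exact ⟨fun t => (hp t).differentiableAt, by rwa [show deriv p = p' from funext fun t => (hp t).deriv]⟩
  have hri : IntervalIntegrable (fun t => p' t * (a x + Q t) + p t * q t) volume x y :=
    (hp'.continuousOn.mul hbac.continuousOn).intervalIntegrable.add
      (hq.continuousOn_mul hpc.continuousOn)
  obtain ⟨R, hRac, hR, hRd⟩ := hri.exists_absolutelyContinuous_primitive
  -- Subtracting the primitive `R` of the expected derivative leaves an absolutely continuous
  -- function with zero derivative almost everywhere, hence a constant.
  have hgac : AbsolutelyContinuousOnInterval (fun t => p t * (a x + Q t) - R t) x y :=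
    (hpac.fun_smul hbac).fun_sub hRac
  have hae : ∀ᵐ t, t ∈ uIcc x y → HasDerivAt (fun t => p t * (a x + Q t) - R t) 0 t := by
    filter_upwards [hQd, hRd] with t h1 h2 ht
    refine (((hp t).mul ((h1 ht).const_add (a x))).sub (h2 ht)).congr_deriv ?_
    ring
  obtain ⟨C, hC⟩ := hgac.const_of_ae_hasDerivAt_zero hae
  have h1 := hC x left_mem_uIcc
  have h2 := hC y right_mem_uIcc
  rw [hR x left_mem_uIcc, intervalIntegral.integral_same, sub_zero, ← haQ x left_mem_uIcc] at h1
  rw [hR y right_mem_uIcc, ← haQ y right_mem_uIcc] at h2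
  have h3 : ∫ t in x..y, (p' t * (a x + Q t) + p t * q t) = ∫ t in x..y, (p' t * a t + p t * q t) :=
    intervalIntegral.integral_congr fun t ht => by simp only [haQ t ht]
  rw [← h3, h1, ← h2]
  ring

open Set in
/-- Iterated Duhamel expansion for an infinite system `aₙ' = κ aₙ₊₁ + fₙ`. -/
theorem eq_sum_add_integral_of_hierarchy {a f : ℕ → ℝ → ℂ} {κ : ℂ} {x y : ℝ}
    (hac : ∀ n, ContinuousOn (a n) (uIcc x y)) (hf : ∀ n, IntervalIntegrable (f n) volume x y)
    (h : ∀ n, ∀ t ∈ uIcc x y, a n t - a n x = ∫ s in x..t, (κ * a (n + 1) s + f n s)) (N : ℕ) :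
    a 0 y = ∑ k ∈ Finset.range (N + 1), (κ * (y - x)) ^ k / k.factorial * a k x +
      ∫ t in x..y, (κ * ((κ * (y - t)) ^ N / N.factorial * a (N + 1) t) +
        ∑ k ∈ Finset.range (N + 1), (κ * (y - t)) ^ k / k.factorial * f k t) := by
  have hpc : ∀ k : ℕ, Continuous fun t : ℝ => (κ * (y - t)) ^ k / (k.factorial : ℂ) := fun k => by
    fun_prop
  have hI1 : ∀ k, IntervalIntegrable
      (fun t : ℝ => κ * ((κ * (y - t)) ^ k / k.factorial * a (k + 1) t)) volume x y := fun k =>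
    (((hpc k).continuousOn.mul (hac (k + 1))).intervalIntegrable).const_mul κ
  have hI2 : ∀ k, IntervalIntegrable
      (fun t : ℝ => (κ * (y - t)) ^ k / k.factorial * f k t) volume x y := fun k =>
    (hf k).continuousOn_mul (hpc k).continuousOn
  have hI3 : ∀ N, IntervalIntegrable (fun t : ℝ => ∑ k ∈ Finset.range (N + 1),
      (κ * (y - t)) ^ k / k.factorial * f k t) volume x y := fun N => by
    have := IntervalIntegrable.sum (Finset.range (N + 1)) (fun k _ => hI2 k)
    simpa only [Finset.sum_fn] using this
  induction N with
  | zero =>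
    have := h 0 y right_mem_uIcc
    rw [sub_eq_iff_eq_add'] at this
    simpa using this
  | succ N ih =>
    -- This weight vanishes at `t = y`, and its derivative is minus `κ` times the preceding weight.
    -- Integrating by parts therefore trades the remainder in `a (N + 1)` for a boundary term at `x`
    -- and a remainder in `a (N + 2)`.
    have hp : ∀ t : ℝ, HasDerivAt (fun t : ℝ => (κ * (y - t)) ^ (N + 1) / ((N + 1).factorial : ℂ))
        (-(κ * ((κ * (y - t)) ^ N / N.factorial))) t := by
      intro t
      have h1 : HasDerivAt (fun t : ℝ => κ * ((y : ℂ) - t)) (κ * -1) t :=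
        ((Complex.ofRealCLM.hasDerivAt (x := t)).const_sub (y : ℂ)).const_mul κ
      refine ((h1.pow (N + 1)).div_const _).congr_deriv ?_
      rw [Nat.factorial_succ, Nat.add_sub_cancel]
      push_cast
      have : (N.factorial : ℂ) ≠ 0 := by exact_mod_cast N.factorial_ne_zero
      have : (N + 1 : ℂ) ≠ 0 := by exact_mod_cast N.succ_ne_zero
      field_simp
    have key := mul_sub_mul_eq_integral_of_primitive hp (by fun_prop)
      (((hac (N + 2)).intervalIntegrable.const_mul κ).add (hf (N + 1))) (h (N + 1))
    rw [ih, Finset.sum_range_succ _ (N + 1), add_assoc]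
    congr 1
    have h0 : ((κ * ((y : ℂ) - y)) ^ (N + 1) / ((N + 1).factorial : ℂ)) = 0 := by simp
    rw [h0, zero_mul, zero_sub, neg_eq_iff_eq_neg] at key
    rw [key, eq_neg_add_iff_add_eq, ← intervalIntegral.integral_add _ ((hI1 N).add (hI3 N))]
    · refine intervalIntegral.integral_congr fun t _ => ?_
      simp only [Finset.sum_range_succ _ (N + 1)]
      ring
    · exact (((hac (N + 1)).intervalIntegrable).continuousOn_mul
        (Continuous.continuousOn (by fun_prop))).add
        ((((hac (N + 2)).intervalIntegrable.const_mul κ).add (hf (N + 1))).continuousOn_mul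
          (hpc (N + 1)).continuousOn)

theorem Complex.norm_sum_pow_div_factorial_le (w : ℂ) (N : ℕ) :
    ‖∑ k ∈ Finset.range N, w ^ k / (k.factorial : ℂ)‖ ≤ Real.exp ‖w‖ := by
  refine (norm_sum_le _ _).trans ?_
  refine le_trans (le_of_eq ?_) (Real.sum_le_exp_of_nonneg (norm_nonneg w) N)
  exact Finset.sum_congr rfl fun k _ => by simp

section ExpMoments

variable {d : ℕ} {g : EuclideanSpace ℝ (Fin d) → ℂ} {R : ℝ}

theorem sum_mul_integral_normSq_pow (hg : Integrable g) (hgR : ∀ ξ, R < ‖ξ‖ → g ξ = 0) (z : ℂ)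
    (N : ℕ) :
    ∑ k ∈ Finset.range N, z ^ k / (k.factorial : ℂ) * ∫ ξ, ((‖ξ‖ ^ 2 : ℝ) : ℂ) ^ k * g ξ =
      ∫ ξ, (∑ k ∈ Finset.range N, (z * ((‖ξ‖ ^ 2 : ℝ) : ℂ)) ^ k / (k.factorial : ℂ)) * g ξ := by
  have hint : ∀ k : ℕ, Integrable fun ξ => ((‖ξ‖ ^ 2 : ℝ) : ℂ) ^ k * g ξ := fun k => by
    refine Integrable.mono' (hg.norm.const_mul ((R ^ 2) ^ k))
      (Continuous.aestronglyMeasurable (by fun_prop) |>.mul hg.aestronglyMeasurable)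
      (.of_forall fun ξ => ?_)
    by_cases h : R < ‖ξ‖
    · simp [hgR ξ h]
    · rw [norm_mul, norm_pow, Complex.norm_real, Real.norm_of_nonneg (by positivity)]
      have : ‖ξ‖ ≤ R := not_lt.1 h
      gcongr
  simp_rw [Finset.sum_mul]
  rw [integral_finsetSum _ fun k _ => ?_]
  · refine Finset.sum_congr rfl fun k _ => ?_
    rw [← integral_const_mul]
    congr 1; ext ξ
    rw [mul_pow]; ring
  · refine ((hint k).const_mul (z ^ k / (k.factorial : ℂ))).congr (.of_forall fun ξ => ?_)
    simp only [mul_pow]; ring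

theorem norm_sum_pow_mul_le (hgR : ∀ ξ, R < ‖ξ‖ → g ξ = 0) (z : ℂ) (N : ℕ)
    (ξ : EuclideanSpace ℝ (Fin d)) :
    ‖(∑ k ∈ Finset.range N, (z * ((‖ξ‖ ^ 2 : ℝ) : ℂ)) ^ k / (k.factorial : ℂ)) * g ξ‖ ≤
      Real.exp (‖z‖ * R ^ 2) * ‖g ξ‖ := by
  by_cases h : R < ‖ξ‖
  · simp [hgR ξ h]
  · rw [norm_mul]
    have : ‖ξ‖ ≤ R := not_lt.1 h
    gcongr
    refine (Complex.norm_sum_pow_div_factorial_le _ _).trans ?_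
    rw [norm_mul, Complex.norm_real, Real.norm_of_nonneg (by positivity)]
    gcongr

theorem norm_sum_mul_integral_normSq_pow_le (hg : Integrable g) (hgR : ∀ ξ, R < ‖ξ‖ → g ξ = 0)
    (z : ℂ) (N : ℕ) :
    ‖∑ k ∈ Finset.range N, z ^ k / (k.factorial : ℂ) * ∫ ξ, ((‖ξ‖ ^ 2 : ℝ) : ℂ) ^ k * g ξ‖ ≤
      Real.exp (‖z‖ * R ^ 2) * ∫ ξ, ‖g ξ‖ := by
  rw [sum_mul_integral_normSq_pow hg hgR, ← integral_const_mul]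
  exact norm_integral_le_of_norm_le (hg.norm.const_mul _)
    (.of_forall fun ξ => norm_sum_pow_mul_le hgR z N ξ)

/-- Dominated convergence: where `g` does not vanish, `‖ξ‖ ≤ R`, so every partial sum of the
exponential is at most `exp (‖z‖ R²)`. -/
theorem tendsto_sum_mul_integral_normSq_pow (hg : Integrable g) (hgR : ∀ ξ, R < ‖ξ‖ → g ξ = 0)
    (z : ℂ) :
    Filter.Tendsto (fun N => ∑ k ∈ Finset.range N, z ^ k / (k.factorial : ℂ) *
      ∫ ξ, ((‖ξ‖ ^ 2 : ℝ) : ℂ) ^ k * g ξ) Filter.atTop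
      (nhds (∫ ξ, Complex.exp (z * ((‖ξ‖ ^ 2 : ℝ) : ℂ)) * g ξ)) := by
  simp_rw [sum_mul_integral_normSq_pow hg hgR]
  refine tendsto_integral_of_dominated_convergence (fun ξ => Real.exp (‖z‖ * R ^ 2) * ‖g ξ‖)
    (fun N => (Continuous.aestronglyMeasurable (by fun_prop)).mul hg.aestronglyMeasurable)
    (hg.norm.const_mul _) (fun N => .of_forall fun ξ => norm_sum_pow_mul_le hgR z N ξ)
    (.of_forall fun ξ => ?_)
  refine Filter.Tendsto.mul_const _ ?_
  rw [Complex.exp_eq_exp_ℂ]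
  exact (NormedSpace.expSeries_div_hasSum_exp _).tendsto_sum_nat

end ExpMoments

theorem SchwartzMap.hasCompactSupport_iterate_normSqMul {V : Type*} [NormedAddCommGroup V]
    [InnerProductSpace ℝ V] {f : 𝓢(V, ℂ)} (hf : HasCompactSupport f) (n : ℕ) :
    HasCompactSupport (SchwartzMap.normSqMul^[n] f) := by
  have : ⇑(SchwartzMap.normSqMul^[n] f) = fun x => ((‖x‖ ^ 2 : ℝ) : ℂ) ^ n * f x :=
    funext fun x => SchwartzMap.iterate_normSqMul_apply f n x
  rw [this]
  exact hf.mul_left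

theorem IsGivenBy.apply_iterate_normSqMul {d : ℕ} {f : 𝓢'(EuclideanSpace ℝ (Fin d), ℂ)}
    {g : EuclideanSpace ℝ (Fin d) → ℂ} (h : IsGivenBy f g) {ψ : 𝓢(EuclideanSpace ℝ (Fin d), ℂ)}
    (hψ : HasCompactSupport ψ) (n : ℕ) :
    f (SchwartzMap.normSqMul^[n] ψ) = ∫ ξ, ((‖ξ‖ ^ 2 : ℝ) : ℂ) ^ n * (g ξ * ψ ξ) := by
  rw [h.2 _ (SchwartzMap.hasCompactSupport_iterate_normSqMul hψ n)]
  congr 1; ext ξ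
  rw [SchwartzMap.iterate_normSqMul_apply]; ring

theorem IsGivenBy.integrable_mul {d : ℕ} {f : 𝓢'(EuclideanSpace ℝ (Fin d), ℂ)}
    {g : EuclideanSpace ℝ (Fin d) → ℂ} (h : IsGivenBy f g) {ψ : 𝓢(EuclideanSpace ℝ (Fin d), ℂ)}
    (hψ : HasCompactSupport ψ) : Integrable fun ξ => g ξ * ψ ξ := by
  simpa only [smul_eq_mul] using
    h.1.integrable_smul_right_of_hasCompactSupport ψ.continuous hψ

theorem tendsto_succ_mul_pow_div {b c : ℝ} (hb : 0 ≤ b) (hc : b < c) :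
    Filter.Tendsto (fun N : ℕ => ((N : ℝ) + 1) * (b ^ N / c ^ (N + 1))) Filter.atTop (nhds 0) := by
  have hc0 : 0 < c := hb.trans_lt hc
  have hr : b / c < 1 := (div_lt_one hc0).2 hc
  have h1 := tendsto_self_mul_const_pow_of_lt_one (r := b / c) (by positivity) hr
  have h2 := tendsto_pow_atTop_nhds_zero_of_lt_one (r := b / c) (by positivity) hr
  have h3 := (h1.add h2).mul_const c⁻¹
  rw [add_zero, zero_mul] at h3
  refine h3.congr fun N => ?_
  rw [div_pow, pow_succ]
  field_simp

open Set in
/-- Duhamel's formula on the Fourier side, as an inequality, for compactly supported frequencies. -/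
theorem IsForcedSchrodinger.enorm_fourier_apply_le_of_hasCompactSupport {d : ℕ} {I : Set ℝ}
    (hI : I.OrdConnected) {u F : ℝ → 𝓢'(EuclideanSpace ℝ (Fin d), ℂ)}
    (hu : IsForcedSchrodinger I u F) {x : ℝ} (hx : x ∈ I) {g₀ : EuclideanSpace ℝ (Fin d) → ℂ}
    (hg₀ : IsGivenBy (𝓕 (u x)) g₀) {G : ℝ → EuclideanSpace ℝ (Fin d) → ℂ}
    (hG : ∀ᵐ t ∂(volume.restrict I), IsGivenBy (𝓕 (F t)) (G t))
    {ψ : 𝓢(EuclideanSpace ℝ (Fin d), ℂ)} (hψ : HasCompactSupport ψ)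
    (hfin : ∫⁻ t in I, ∫⁻ ξ, ‖G t ξ * ψ ξ‖ₑ ≠ ⊤) {y : ℝ} (hy : y ∈ I) :
    ‖(𝓕 (u y)) ψ‖ₑ ≤
      ‖∫ ξ, Complex.exp (-(4 * Real.pi ^ 2 * Complex.I) * (y - x) * ((‖ξ‖ ^ 2 : ℝ) : ℂ)) *
        (g₀ ξ * ψ ξ)‖ₑ +
      ∫⁻ t in I, ‖∫ ξ, Complex.exp (-(4 * Real.pi ^ 2 * Complex.I) * (y - t) *
        ((‖ξ‖ ^ 2 : ℝ) : ℂ)) * (G t ξ * ψ ξ)‖ₑ := by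
  obtain ⟨κ, hκ⟩ : ∃ κ : ℂ, κ = -(4 * Real.pi ^ 2 * Complex.I) := ⟨_, rfl⟩
  rw [← hκ]
  obtain ⟨R, hR, hψR⟩ := hψ.isCompact.isBounded.exists_pos_norm_le
  have hsupp : ∀ (h : EuclideanSpace ℝ (Fin d) → ℂ) ξ, R < ‖ξ‖ → h ξ * ψ ξ = 0 := fun h ξ hξ => by
    rw [image_eq_zero_of_notMem_tsupport fun hm => (hψR ξ hm).not_gt hξ, mul_zero]
  have hsub : uIcc x y ⊆ I := hI.uIcc_subset hx hy
  have hsub' : uIoc x y ⊆ I := uIoc_subset_uIcc.trans hsub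
  -- The moments of `û(t)` against `|ξ|^(2n) ψ`. The equation tested with `𝓕(|ξ|^(2n) ψ)` says `aₙ'
  -- = κ aₙ₊₁ + fₙ`, which avoids time-dependent test functions.
  obtain ⟨a, ha⟩ : ∃ a : ℕ → ℝ → ℂ, a = fun n t => (𝓕 (u t)) (SchwartzMap.normSqMul^[n] ψ) := ⟨_, rfl⟩
  obtain ⟨f, hf⟩ : ∃ f : ℕ → ℝ → ℂ, f = fun n t => -Complex.I * (𝓕 (F t)) (SchwartzMap.normSqMul^[n] ψ) := ⟨_, rfl⟩
  have hac : ∀ n, ContinuousOn (a n) (uIcc x y) := fun n => by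
    rw [ha]; exact (hu.continuousOn (𝓕 (SchwartzMap.normSqMul^[n] ψ))).mono hsub
  have hfi : ∀ n, IntervalIntegrable (f n) volume x y := fun n => by
    have h1 : IntegrableOn (fun t => F t (𝓕 (SchwartzMap.normSqMul^[n] ψ))) (uIcc x y) volume :=
      (hu.locallyIntegrableOn _).integrableOn_compact_subset hsub isCompact_uIcc
    rw [hf]
    exact (intervalIntegrable_iff.2 (h1.mono_set uIoc_subset_uIcc)).const_mul _
  have heq : ∀ n, ∀ t ∈ uIcc x y, a n t - a n x = ∫ s in x..t, (κ * a (n + 1) s + f n s) := by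
    intro n t ht
    rw [ha, hf, hκ]
    refine (hu.equation (𝓕 (SchwartzMap.normSqMul^[n] ψ)) x hx t (hsub ht)).trans ?_
    refine intervalIntegral.integral_congr fun s _ => ?_
    simp only [TemperedDistribution.fourier_laplacian_apply, Function.iterate_succ_apply',
      TemperedDistribution.fourier_apply]
    push_cast
    ring
  -- uniform bound on the remainder
  set T : ℝ := ‖κ‖ * |y - x| with hT
  have hT0 : 0 ≤ T := by positivity
  -- Choosing `T + 1` rather than `T` leaves room: the moments are `O(n!/(T+1)^n)` uniformly in
  -- time, so the remainder of order `N` is `O((N+1) T^N/(T+1)^(N+1))`.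
  obtain ⟨B, hB⟩ := SchwartzMap.exists_seminorm_iterate_normSqMul_le hψ (T + 1) (by positivity)
  obtain ⟨C, hC⟩ := TemperedDistribution.exists_bound_of_pointwise_bounded hB
    (w := fun t : uIcc x y => 𝓕 (u t)) (fun φ => by
      obtain ⟨C, hC⟩ := isCompact_uIcc.exists_bound_of_continuousOn ((hu.continuousOn (𝓕 φ)).mono hsub)
      exact ⟨C, fun t => hC t t.2⟩)
  have hC' : ∀ n, ∀ t ∈ uIcc x y, ‖a n t‖ ≤ C * (n.factorial / (T + 1) ^ n) := by
    intro n t ht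
    have h1 := hC ⟨t, ht⟩ n
    rw [map_smul, norm_smul, Complex.norm_real, Real.norm_of_nonneg (by positivity)] at h1
    rw [ha, ← div_le_iff₀ (by positivity), div_div_eq_mul_div, mul_div_assoc, mul_comm]
    exact h1
  have hC0 : 0 ≤ C := (norm_nonneg _).trans (hC ⟨x, left_mem_uIcc⟩ 0)
  have hκy : ∀ t ∈ uIcc x y, ‖κ * ((y : ℂ) - t)‖ ≤ T := by
    intro t ht
    rw [norm_mul, ← Complex.ofReal_sub, Complex.norm_real, Real.norm_eq_abs, hT]
    gcongr 1
    exact abs_sub_le_of_uIcc_subset_uIcc (uIcc_subset_uIcc_right ht)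
  have hGI : ∀ᵐ t ∂(volume.restrict (uIoc x y)), IsGivenBy (𝓕 (F t)) (G t) :=
    ae_mono (Measure.restrict_mono hsub' le_rfl) hG
  -- the polynomial approximations of the propagator
  have hlim0 : Filter.Tendsto (fun N => ‖∑ k ∈ Finset.range (N + 1),
      (κ * (y - x)) ^ k / k.factorial * a k x‖ₑ) Filter.atTop
      (nhds ‖∫ ξ, Complex.exp (κ * (y - x) * ((‖ξ‖ ^ 2 : ℝ) : ℂ)) * (g₀ ξ * ψ ξ)‖ₑ) := by
    have h1 := (tendsto_sum_mul_integral_normSq_pow (hg₀.integrable_mul hψ) (hsupp g₀)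
      (κ * (y - x))).enorm.comp (Filter.tendsto_add_atTop_nat 1)
    refine h1.congr fun N => ?_
    simp only [Function.comp, ha, hg₀.apply_iterate_normSqMul hψ]
  have hS : ∀ᵐ t ∂(volume.restrict (uIoc x y)), ∀ N : ℕ,
      ‖∑ k ∈ Finset.range (N + 1), (κ * (y - t)) ^ k / k.factorial * f k t‖ₑ =
      ‖∑ k ∈ Finset.range (N + 1), (κ * (y - t)) ^ k / (k.factorial : ℂ) *
        ∫ ξ, ((‖ξ‖ ^ 2 : ℝ) : ℂ) ^ k * (G t ξ * ψ ξ)‖ₑ := by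
    filter_upwards [hGI] with t ht N
    have : ∑ k ∈ Finset.range (N + 1), (κ * (y - t)) ^ k / k.factorial * f k t =
        -Complex.I * ∑ k ∈ Finset.range (N + 1), (κ * (y - t)) ^ k / (k.factorial : ℂ) *
        ∫ ξ, ((‖ξ‖ ^ 2 : ℝ) : ℂ) ^ k * (G t ξ * ψ ξ) := by
      rw [Finset.mul_sum]
      refine Finset.sum_congr rfl fun k _ => ?_
      simp only [hf, ht.apply_iterate_normSqMul hψ]
      ring
    rw [this, enorm_mul]
    simp [enorm_eq_nnnorm]
  have hSm : ∀ N : ℕ, AEMeasurable (fun t : ℝ =>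
      ‖∑ k ∈ Finset.range (N + 1), (κ * (y - t)) ^ k / k.factorial * f k t‖ₑ)
      (volume.restrict (uIoc x y)) := fun N => by
    refine AEStronglyMeasurable.enorm ?_
    refine Finset.aestronglyMeasurable_fun_sum _ fun k _ => ?_
    exact (Continuous.aestronglyMeasurable (by fun_prop)).mul
      (intervalIntegrable_iff.1 (hfi k)).aestronglyMeasurable
  have hlim1 : Filter.Tendsto (fun N : ℕ => ∫⁻ t in uIoc x y,
      ‖∑ k ∈ Finset.range (N + 1), (κ * (y - t)) ^ k / k.factorial * f k t‖ₑ) Filter.atTop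
      (nhds (∫⁻ t in uIoc x y, ‖∫ ξ, Complex.exp (κ * (y - t) *
        ((‖ξ‖ ^ 2 : ℝ) : ℂ)) * (G t ξ * ψ ξ)‖ₑ)) := by
    refine tendsto_lintegral_of_dominated_convergence'
      (fun t => ENNReal.ofReal (Real.exp (T * R ^ 2)) * ∫⁻ ξ, ‖G t ξ * ψ ξ‖ₑ) hSm
      (fun N => ?_) ?_ ?_
    · filter_upwards [hS, hGI, ae_restrict_mem measurableSet_uIoc] with t ht hGt htm
      rw [ht N, ← ofReal_integral_norm_eq_lintegral_enorm (hGt.integrable_mul hψ),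
        ← ENNReal.ofReal_mul (Real.exp_pos _).le, ← ofReal_norm]
      refine ENNReal.ofReal_le_ofReal ?_
      refine (norm_sum_mul_integral_normSq_pow_le (hGt.integrable_mul hψ) (hsupp (G t)) _
        _).trans ?_
      have := hκy t (uIoc_subset_uIcc htm)
      have h0 : 0 ≤ ∫ ξ, ‖G t ξ * ψ ξ‖ := integral_nonneg fun _ => norm_nonneg _
      gcongr
    · rw [lintegral_const_mul' _ _ ENNReal.ofReal_ne_top]
      exact ENNReal.mul_ne_top ENNReal.ofReal_ne_top
        (ne_top_of_le_ne_top hfin (lintegral_mono_set hsub'))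
    · filter_upwards [hS, hGI] with t ht hGt
      have h1 := (tendsto_sum_mul_integral_normSq_pow (hGt.integrable_mul hψ) (hsupp (G t))
        (κ * (y - t))).enorm.comp (Filter.tendsto_add_atTop_nat 1)
      exact h1.congr fun N => (ht N).symm
  -- the remainder
  have hlim2 : Filter.Tendsto (fun N : ℕ => ENNReal.ofReal (‖κ‖ * C * (((N : ℝ) + 1) *
      (T ^ N / (T + 1) ^ (N + 1)))) * volume (uIoc x y)) Filter.atTop (nhds 0) := by
    have h1 := (tendsto_succ_mul_pow_div hT0 (lt_add_one T)).const_mul (‖κ‖ * C)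
    rw [mul_zero] at h1
    have h2 := ENNReal.tendsto_ofReal h1
    rw [ENNReal.ofReal_zero] at h2
    have hv : volume (uIoc x y) ≠ ⊤ := by rw [uIoc]; exact measure_Ioc_lt_top.ne
    simpa using ENNReal.Tendsto.mul_const h2 (Or.inr hv)
  have hbound : ∀ N : ℕ, ‖a 0 y‖ₑ ≤ ‖∑ k ∈ Finset.range (N + 1),
      (κ * (y - x)) ^ k / k.factorial * a k x‖ₑ + (ENNReal.ofReal (‖κ‖ * C * (((N : ℝ) + 1) *
      (T ^ N / (T + 1) ^ (N + 1)))) * volume (uIoc x y) + ∫⁻ t in uIoc x y,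
      ‖∑ k ∈ Finset.range (N + 1), (κ * (y - t)) ^ k / k.factorial * f k t‖ₑ) := by
    intro N
    rw [eq_sum_add_integral_of_hierarchy hac hfi heq N]
    refine (enorm_add_le _ _).trans (add_le_add le_rfl ?_)
    rw [← ofReal_norm, intervalIntegral.norm_intervalIntegral_eq, ofReal_norm]
    refine (enorm_integral_le_lintegral_enorm _).trans ?_
    rw [← setLIntegral_const, ← lintegral_add_left measurable_const]
    refine setLIntegral_mono_ae' measurableSet_uIoc (.of_forall fun t ht => ?_)
    refine (enorm_add_le _ _).trans (add_le_add ?_ le_rfl)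
    rw [← ofReal_norm]
    refine ENNReal.ofReal_le_ofReal ?_
    have h1 := hκy t (uIoc_subset_uIcc ht)
    have h2 := hC' (N + 1) t (uIoc_subset_uIcc ht)
    rw [norm_mul, norm_mul, norm_div, norm_pow, Complex.norm_natCast]
    calc ‖κ‖ * (‖κ * ((y : ℂ) - t)‖ ^ N / N.factorial * ‖a (N + 1) t‖)
        ≤ ‖κ‖ * (T ^ N / N.factorial * (C * ((N + 1).factorial / (T + 1) ^ (N + 1)))) := by
          gcongr
      _ = _ := by
          rw [Nat.factorial_succ]; push_cast
          have : (N.factorial : ℝ) ≠ 0 := by positivity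
          field_simp
  have hlim := hlim0.add (hlim2.add hlim1)
  rw [zero_add] at hlim
  have h3 := ge_of_tendsto' hlim hbound
  rw [ha] at h3
  exact h3.trans (add_le_add le_rfl (lintegral_mono_set hsub'))

/-! ### Duality between weighted `L²` and Schwartz functions. -/

section Weighted

variable {d : ℕ}

theorem integrable_norm_rpow_ite [NeZero d] {s k : ℝ} (hs : 2 * s < d) (hk : d < 2 * s + k) :
    Integrable fun ξ : EuclideanSpace ℝ (Fin d) =>
      if ‖ξ‖ ≤ 1 then ‖ξ‖ ^ (-(2 * s)) else ‖ξ‖ ^ (-(2 * s) - k) := by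
  have hd : 0 < d := Nat.pos_of_ne_zero (NeZero.ne d)
  have : Nontrivial (EuclideanSpace ℝ (Fin d)) := by
    have : Nonempty (Fin d) := ⟨⟨0, hd⟩⟩
    infer_instance
  refine (integrable_fun_norm_addHaar (volume : Measure (EuclideanSpace ℝ (Fin d)))
    (f := fun y : ℝ => if y ≤ 1 then y ^ (-(2 * s)) else y ^ (-(2 * s) - k))).2 ?_
  rw [finrank_euclideanSpace_fin]
  have hpow : ∀ y : ℝ, 0 < y → ∀ a : ℝ, y ^ (d - 1) • y ^ a = y ^ ((d : ℝ) - 1 + a) := by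
    intro y hy a
    rw [smul_eq_mul, Real.rpow_add hy, ← Real.rpow_natCast, Nat.cast_sub (by omega), Nat.cast_one]
  rw [← Set.Ioc_union_Ioi_eq_Ioi zero_le_one]
  refine IntegrableOn.union ?_ ?_
  · have h1 : IntegrableOn (fun y : ℝ => y ^ ((d : ℝ) - 1 + -(2 * s))) (Set.Ioc 0 1) :=
      (intervalIntegrable_iff_integrableOn_Ioc_of_le zero_le_one).1
        (intervalIntegral.intervalIntegrable_rpow' (by linarith))
    refine h1.congr_fun (fun y hy => ?_) measurableSet_Ioc
    simp only [if_pos hy.2, hpow y hy.1]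
  · have h1 : IntegrableOn (fun y : ℝ => y ^ ((d : ℝ) - 1 + (-(2 * s) - k))) (Set.Ioi 1) :=
      integrableOn_Ioi_rpow_of_lt (by linarith) zero_lt_one
    refine h1.congr_fun (fun y hy => ?_) measurableSet_Ioi
    have hy' : (1 : ℝ) < y := hy
    simp only [if_neg hy'.not_ge, hpow y (zero_lt_one.trans hy')]

theorem weightedL2_neg_schwartz_ne_top [NeZero d] {s : ℝ} (hs : 2 * s < d)
    (ψ : 𝓢(EuclideanSpace ℝ (Fin d), ℂ)) : weightedL2 (-s) ψ ≠ ⊤ := by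
  obtain ⟨k, hk⟩ := exists_nat_gt ((d : ℝ) - 2 * s)
  obtain ⟨C₀, hC₀, h₀⟩ := ψ.decay 0 0
  obtain ⟨C₁, hC₁, h₁⟩ := ψ.decay k 0
  simp only [norm_iteratedFDeriv_zero, pow_zero, one_mul] at h₀ h₁
  -- One constant for both regions: `|ψ|² ≤ C₀²` in the unit ball, and `|ξ|^k |ψ|² ≤ C₁ C₀` outside.
  -- The condition `2s < d` handles the origin, and `k > d - 2s` handles infinity.
  obtain ⟨D, hD⟩ : ∃ D, D = C₀ ^ 2 + C₁ * C₀ := ⟨_, rfl⟩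
  have hint := (integrable_norm_rpow_ite (d := d) hs (k := k) (by linarith)).const_mul D
  rw [weightedL2_eq]
  refine ENNReal.rpow_ne_top_of_nonneg (by norm_num) (ne_top_of_le_ne_top hint.lintegral_lt_top.ne
    (lintegral_mono_ae (.of_forall fun ξ => ?_)))
  rw [← ofReal_norm, ← ENNReal.ofReal_mul (by positivity),
    ENNReal.ofReal_rpow_of_nonneg (by positivity) (by norm_num)]
  refine ENNReal.ofReal_le_ofReal ?_
  rw [Real.rpow_two, mul_pow, ← Real.rpow_natCast (‖ξ‖ ^ (-s)), ← Real.rpow_mul (norm_nonneg _)]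
  have he : -s * ((2 : ℕ) : ℝ) = -(2 * s) := by push_cast; ring
  rw [he, mul_comm]
  have hψ0 := norm_nonneg (ψ ξ)
  have hC0 : 0 < C₀ := hC₀
  have hC1 : 0 < C₁ := hC₁
  split_ifs with h
  · refine mul_le_mul_of_nonneg_right ?_ (by positivity)
    have := h₀ ξ
    rw [hD]
    nlinarith [mul_pos hC1 hC0]
  · have hξ : 0 < ‖ξ‖ := zero_lt_one.trans (not_le.1 h)
    rw [Real.rpow_sub hξ, Real.rpow_natCast, mul_div_assoc', le_div_iff₀ (by positivity),
      mul_right_comm]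
    refine mul_le_mul_of_nonneg_right ?_ (by positivity)
    have h2 := mul_le_mul (h₁ ξ) (h₀ ξ) hψ0 hC1.le
    rw [hD]
    nlinarith [sq_nonneg C₀]

theorem lintegral_enorm_mul_le_weightedL2 [NeZero d] {s : ℝ} {h k : EuclideanSpace ℝ (Fin d) → ℂ}
    (hh : AEStronglyMeasurable h) (hk : AEStronglyMeasurable k) :
    ∫⁻ ξ, ‖h ξ * k ξ‖ₑ ≤ weightedL2 s h * weightedL2 (-s) k := by
  have hm : ∀ a : ℝ, ∀ g : EuclideanSpace ℝ (Fin d) → ℂ, AEStronglyMeasurable g →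
      AEMeasurable fun ξ => ENNReal.ofReal (‖ξ‖ ^ a) * ‖g ξ‖ₑ := fun a g hg =>
    (Measurable.aemeasurable (by fun_prop)).mul hg.enorm
  rw [weightedL2_eq, weightedL2_eq]
  refine le_trans ?_ (ENNReal.lintegral_mul_le_Lp_mul_Lq volume Real.HolderConjugate.two_two
    (hm s h hh) (hm (-s) k hk))
  have : Nontrivial (EuclideanSpace ℝ (Fin d)) := by
    have : Nonempty (Fin d) := ⟨⟨0, Nat.pos_of_ne_zero (NeZero.ne d)⟩⟩
    infer_instance
  refine lintegral_mono_ae ?_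
  filter_upwards [Measure.ae_ne volume (0 : EuclideanSpace ℝ (Fin d))] with ξ hξ
  have hξ' : 0 < ‖ξ‖ := norm_pos_iff.2 hξ
  rw [Pi.mul_apply, mul_mul_mul_comm, ← ENNReal.ofReal_mul (by positivity), ← Real.rpow_add hξ',
    add_neg_cancel, Real.rpow_zero, ENNReal.ofReal_one, one_mul, enorm_mul]

end Weighted

/-! ### Solutions as superpositions of free waves. -/

section Superposition

variable {d : ℕ}

theorem IsGivenBy.congr_ae {f : 𝓢'(EuclideanSpace ℝ (Fin d), ℂ)}
    {g g' : EuclideanSpace ℝ (Fin d) → ℂ} (h : IsGivenBy f g) (hg : g =ᵐ[volume] g') :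
    IsGivenBy f g' := by
  refine ⟨fun x => ?_, fun φ hφ => (h.2 φ hφ).trans (integral_congr_ae ?_)⟩
  · obtain ⟨s, hs, hi⟩ := h.1 x
    exact ⟨s, hs, hi.congr_fun_ae (ae_restrict_of_ae hg)⟩
  · filter_upwards [hg] with ξ hξ
    rw [hξ]

theorem weightedL2_congr_ae {s : ℝ} {g g' : EuclideanSpace ℝ (Fin d) → ℂ} (hg : g =ᵐ[volume] g') :
    weightedL2 s g = weightedL2 s g' := by
  refine eLpNorm_congr_ae ?_
  filter_upwards [hg] with ξ hξ
  rw [hξ]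

theorem measurable_weightedL2 {s : ℝ} {α : Type*} [MeasurableSpace α]
    {h : α → EuclideanSpace ℝ (Fin d) → ℂ} (hh : Measurable (Function.uncurry h)) :
    Measurable fun r => weightedL2 s (h r) := by
  simp_rw [weightedL2_eq]
  refine Measurable.pow_const (Measurable.lintegral_prod_right' (f := fun p : α × _ =>
    (ENNReal.ofReal (‖p.2‖ ^ s) * ‖h p.1 p.2‖ₑ) ^ (2 : ℝ)) ?_) _
  refine Measurable.pow_const (Measurable.mul (by fun_prop) hh.enorm) _

theorem exists_measurable_isGivenBy_of_homSobolevNorm_lt {s : ℝ}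
    {f : 𝓢'(EuclideanSpace ℝ (Fin d), ℂ)} {M : ℝ≥0∞} (h : homSobolevNorm s f < M) :
    ∃ g : EuclideanSpace ℝ (Fin d) → ℂ, Measurable g ∧ IsGivenBy (𝓕 f) g ∧
      weightedL2 s g < M := by
  simp only [homSobolevNorm, iInf_lt_iff] at h
  obtain ⟨g, hg, hgM⟩ := h
  have hm := hg.1.aestronglyMeasurable
  refine ⟨hm.mk g, hm.stronglyMeasurable_mk.measurable, hg.congr_ae hm.ae_eq_mk, ?_⟩
  rwa [← weightedL2_congr_ae hm.ae_eq_mk]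

theorem exists_measurable_isGivenBy_of_timeL1HomSobolevNorm_lt {s : ℝ} {I : Set ℝ}
    {F : ℝ → 𝓢'(EuclideanSpace ℝ (Fin d), ℂ)} {M : ℝ≥0∞} (h : timeL1HomSobolevNorm I s F < M) :
    ∃ G : ℝ → EuclideanSpace ℝ (Fin d) → ℂ, Measurable (Function.uncurry G) ∧
      (∀ᵐ t ∂(volume.restrict I), IsGivenBy (𝓕 (F t)) (G t)) ∧
      ∫⁻ t in I, weightedL2 s (G t) < M := by
  simp only [timeL1HomSobolevNorm, iInf_lt_iff] at h
  obtain ⟨G, hm, hG, hGM⟩ := h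
  have hae : ∀ᵐ t ∂(volume.restrict I), G t =ᵐ[volume] Function.curry (hm.mk _) t :=
    Measure.ae_ae_of_ae_prod hm.ae_eq_mk
  refine ⟨Function.curry (hm.mk _), ?_, ?_, ?_⟩
  · rw [Function.uncurry_curry]
    exact hm.stronglyMeasurable_mk.measurable
  · filter_upwards [hae, hG] with t ht hGt
    exact hGt.congr_ae ht
  · refine lt_of_eq_of_lt (lintegral_congr_ae ?_) hGM
    filter_upwards [hae] with t ht
    exact (weightedL2_congr_ae ht).symm

/-- A bound by a superposition of integrals extends from compactly supported to all Schwartz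
functions. -/
theorem TemperedDistribution.enorm_apply_le_of_forall_hasCompactSupport [NeZero d] {s : ℝ}
    (hs : 2 * s < d) {α : Type*} [MeasurableSpace α] {μ : Measure α}
    {h : α → EuclideanSpace ℝ (Fin d) → ℂ} (hh : Measurable (Function.uncurry h))
    (hfin : ∫⁻ r, weightedL2 s (h r) ∂μ ≠ ⊤) {w : 𝓢'(EuclideanSpace ℝ (Fin d), ℂ)}
    (hw : ∀ ψ : 𝓢(EuclideanSpace ℝ (Fin d), ℂ), HasCompactSupport ψ →
      ‖w ψ‖ₑ ≤ ∫⁻ r, ‖∫ ξ, h r ξ * ψ ξ‖ₑ ∂μ) (ψ : 𝓢(EuclideanSpace ℝ (Fin d), ℂ)) :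
    ‖w ψ‖ₑ ≤ ∫⁻ r, ‖∫ ξ, h r ξ * ψ ξ‖ₑ ∂μ := by
  obtain ⟨g, hgc, hgle, hgt, hgψ⟩ := SchwartzMap.exists_seq_hasCompactSupport_tendsto ψ
  have hhr : ∀ r, Measurable (h r) := fun r => hh.comp measurable_prodMk_left
  have hm : ∀ φ : 𝓢(EuclideanSpace ℝ (Fin d), ℂ), Measurable fun r => ‖∫ ξ, h r ξ * φ ξ‖ₑ := by
    intro φ
    refine Measurable.enorm ?_
    refine (StronglyMeasurable.integral_prod_right (f := fun r ξ => h r ξ * φ ξ) ?_).measurable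
    exact (hh.mul (φ.continuous.measurable.comp measurable_snd)).stronglyMeasurable
  have hW := weightedL2_neg_schwartz_ne_top hs ψ
  have hle : ∀ r, ∫⁻ ξ, ‖h r ξ * ψ ξ‖ₑ ≤ weightedL2 s (h r) * weightedL2 (-s) ψ := fun r =>
    lintegral_enorm_mul_le_weightedL2 (hhr r).aestronglyMeasurable
      ψ.continuous.aestronglyMeasurable
  have h1 : Filter.Tendsto (fun j => ‖w (g j)‖ₑ) Filter.atTop (nhds ‖w ψ‖ₑ) :=
    ((w.continuous.tendsto ψ).comp hgψ).enorm
  refine le_of_tendsto_of_tendsto' h1 ?_ fun j => hw (g j) (hgc j)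
  refine tendsto_lintegral_of_dominated_convergence
    (fun r => weightedL2 s (h r) * weightedL2 (-s) ψ) (fun j => hm (g j)) (fun j => ?_) ?_ ?_
  · refine .of_forall fun r => (enorm_integral_le_lintegral_enorm _).trans (le_trans ?_ (hle r))
    refine lintegral_mono fun ξ => ?_
    rw [enorm_mul, enorm_mul]
    exact mul_le_mul' le_rfl (enorm_le_iff_norm_le.2 (hgle j ξ))
  · rw [lintegral_mul_const' _ _ hW]
    exact ENNReal.mul_ne_top hfin hW
  · filter_upwards [ae_lt_top (measurable_weightedL2 hh) hfin] with r hr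
    refine Filter.Tendsto.enorm ?_
    refine tendsto_integral_of_dominated_convergence (fun ξ => ‖h r ξ * ψ ξ‖)
      (fun j => ((hhr r).mul (g j).continuous.measurable).aestronglyMeasurable) ?_ (fun j => ?_)
      (.of_forall fun ξ => (hgt ξ).const_mul _)
    · refine Integrable.norm ⟨((hhr r).mul ψ.continuous.measurable).aestronglyMeasurable, ?_⟩
      exact (hle r).trans_lt (ENNReal.mul_lt_top hr hW.lt_top)
    · refine .of_forall fun ξ => ?_
      rw [norm_mul, norm_mul]
      exact mul_le_mul_of_nonneg_left (hgle j ξ) (norm_nonneg _)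

/-- The Fourier multiplier `exp (-4π²i t|ξ|²)` of the free Schrödinger propagator at time `t`. -/
noncomputable def freePropagator (t : ℝ) (ξ : EuclideanSpace ℝ (Fin d)) : ℂ :=
  Complex.exp (-(4 * Real.pi ^ 2 * Complex.I) * t * ((‖ξ‖ ^ 2 : ℝ) : ℂ))

theorem norm_freePropagator (t : ℝ) (ξ : EuclideanSpace ℝ (Fin d)) : ‖freePropagator t ξ‖ = 1 := by
  have : -(4 * Real.pi ^ 2 * Complex.I) * t * ((‖ξ‖ ^ 2 : ℝ) : ℂ) =
      ((-(4 * Real.pi ^ 2) * t * ‖ξ‖ ^ 2 : ℝ) : ℂ) * Complex.I := by push_cast; ring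
  rw [freePropagator, this, Complex.norm_exp_ofReal_mul_I]

theorem freePropagator_add (t t' : ℝ) (ξ : EuclideanSpace ℝ (Fin d)) :
    freePropagator (t + t') ξ = freePropagator t ξ * freePropagator t' ξ := by
  rw [freePropagator, freePropagator, freePropagator, ← Complex.exp_add]
  congr 1; push_cast; ring

theorem measurable_uncurry_freePropagator :
    Measurable (Function.uncurry (freePropagator (d := d))) := by
  refine Continuous.measurable ?_
  unfold freePropagator Function.uncurry
  fun_prop

theorem weightedL2_mul_of_norm_eq_one {s : ℝ} {m h : EuclideanSpace ℝ (Fin d) → ℂ}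
    (hm : ∀ ξ, ‖m ξ‖ = 1) : weightedL2 s (fun ξ => m ξ * h ξ) = weightedL2 s h := by
  refine eLpNorm_congr_norm_ae (.of_forall fun ξ => ?_)
  rw [norm_mul, norm_mul, norm_mul, hm, one_mul]

/-- A solution of the forced equation is dominated, on the Fourier side, by a superposition of free
waves of finite total norm. -/
theorem IsForcedSchrodinger.exists_superposition [NeZero d] {s : ℝ} (hs : 2 * s < d) {I : Set ℝ}
    (hI : I.OrdConnected) {u F : ℝ → 𝓢'(EuclideanSpace ℝ (Fin d), ℂ)}
    (hu : IsForcedSchrodinger I u F) {t₀ : ℝ} (ht₀ : t₀ ∈ I) {M : ℝ≥0∞}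
    (hM : homSobolevNorm s (u t₀) + timeL1HomSobolevNorm I s F < M) :
    ∃ (μ : Measure ℝ) (h : ℝ → EuclideanSpace ℝ (Fin d) → ℂ), SFinite μ ∧
      Measurable (Function.uncurry h) ∧ ∫⁻ r, weightedL2 s (h r) ∂μ < M ∧
      ∀ y ∈ I, ∀ ψ : 𝓢(EuclideanSpace ℝ (Fin d), ℂ), ‖(𝓕 (u y)) ψ‖ₑ ≤
        ∫⁻ r, ‖∫ ξ, freePropagator y ξ * h r ξ * ψ ξ‖ₑ ∂μ := by
  obtain ⟨ε, hε, hεM⟩ := ENNReal.lt_iff_exists_add_pos_lt.1 hM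
  have hfin := ENNReal.add_ne_top.1 hM.ne_top
  have hε2 : ((ε / 2 : ℝ≥0) : ℝ≥0∞) ≠ 0 := by
    simpa using hε.ne'
  obtain ⟨g₀, hg₀m, hg₀, hg₀M⟩ := exists_measurable_isGivenBy_of_homSobolevNorm_lt
    (ENNReal.lt_add_right hfin.1 hε2)
  obtain ⟨G, hGm, hG, hGM⟩ := exists_measurable_isGivenBy_of_timeL1HomSobolevNorm_lt
    (ENNReal.lt_add_right hfin.2 hε2)
  have hsum : weightedL2 s g₀ + ∫⁻ t in I, weightedL2 s (G t) < M := by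
    refine lt_of_le_of_lt (add_le_add hg₀M.le hGM.le) ?_
    rw [add_add_add_comm, ← ENNReal.coe_add, add_halves]
    exact hεM
  -- Datum and forcing are merged into one family of profiles, pulled back to time zero and
  -- integrated against `Measure.dirac t₀ + volume.restrict I`. Overwriting `G` at `r = t₀` is
  -- harmless, since a single time is Lebesgue null.
  obtain ⟨h, hh⟩ : ∃ h : ℝ → EuclideanSpace ℝ (Fin d) → ℂ, h = fun r ξ =>
    freePropagator (-r) ξ * if r = t₀ then g₀ ξ else G r ξ := ⟨_, rfl⟩
  have hhm : Measurable (Function.uncurry h) := by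
    rw [hh]
    refine Measurable.mul (f := fun p : ℝ × EuclideanSpace ℝ (Fin d) => freePropagator (-p.1) p.2)
      (measurable_uncurry_freePropagator.comp (by fun_prop : Measurable fun
        p : ℝ × EuclideanSpace ℝ (Fin d) => (-p.1, p.2))) ?_
    exact Measurable.ite (measurable_fst (measurableSet_singleton t₀))
      (hg₀m.comp measurable_snd) hGm
  have hht : h t₀ = fun ξ => freePropagator (-t₀) ξ * g₀ ξ := by rw [hh]; simp
  have hhr : ∀ᵐ r ∂(volume.restrict I), h r = fun ξ => freePropagator (-r) ξ * G r ξ := by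
    filter_upwards [ae_restrict_of_ae (Measure.ae_ne volume t₀)] with r hr
    rw [hh]; simp [hr]
  have hlint : ∀ Φ : (EuclideanSpace ℝ (Fin d) → ℂ) → ℝ≥0∞,
      ∫⁻ r, Φ (h r) ∂(Measure.dirac t₀ + volume.restrict I) =
        Φ (fun ξ => freePropagator (-t₀) ξ * g₀ ξ) +
          ∫⁻ r in I, Φ (fun ξ => freePropagator (-r) ξ * G r ξ) := fun Φ => by
    rw [lintegral_add_measure, lintegral_dirac, hht]
    congr 1
    refine lintegral_congr_ae ?_
    filter_upwards [hhr] with r hr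
    rw [hr]
  have hN : ∫⁻ r, weightedL2 s (h r) ∂(Measure.dirac t₀ + volume.restrict I) < M := by
    rw [hlint]
    simpa only [weightedL2_mul_of_norm_eq_one (norm_freePropagator _)] using hsum
  refine ⟨Measure.dirac t₀ + volume.restrict I, h, inferInstance, hhm, hN, fun y hy => ?_⟩
  refine TemperedDistribution.enorm_apply_le_of_forall_hasCompactSupport hs
    (h := fun r ξ => freePropagator y ξ * h r ξ) ?_ ?_ fun ψ hψ => ?_
  · refine Measurable.mul (f := fun p : ℝ × EuclideanSpace ℝ (Fin d) => freePropagator y p.2)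
      (measurable_uncurry_freePropagator.comp (by fun_prop : Measurable fun
        p : ℝ × EuclideanSpace ℝ (Fin d) => (y, p.2))) hhm
  · simp_rw [weightedL2_mul_of_norm_eq_one (norm_freePropagator _)]
    exact hN.ne_top
  · rw [hlint fun k => ‖∫ ξ, freePropagator y ξ * k ξ * ψ ξ‖ₑ]
    have hexp : ∀ (r : ℝ) (k : EuclideanSpace ℝ (Fin d) → ℂ),
        (fun ξ => freePropagator y ξ * (freePropagator (-r) ξ * k ξ) * ψ ξ) = fun ξ =>
        Complex.exp (-(4 * Real.pi ^ 2 * Complex.I) * (y - r) * ((‖ξ‖ ^ 2 : ℝ) : ℂ)) *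
          (k ξ * ψ ξ) := fun r k => by
      ext ξ
      rw [← mul_assoc (freePropagator y ξ), ← freePropagator_add, freePropagator, mul_assoc]
      push_cast
      rw [← sub_eq_add_neg]
    simp only [hexp]
    refine hu.enorm_fourier_apply_le_of_hasCompactSupport hI ht₀ hg₀ hG hψ ?_ hy
    have hW := weightedL2_neg_schwartz_ne_top hs ψ
    refine ne_top_of_le_ne_top (b := ∫⁻ t in I, weightedL2 s (G t) * weightedL2 (-s) ψ) ?_
      (lintegral_mono fun t => lintegral_enorm_mul_le_weightedL2
        (hGm.comp measurable_prodMk_left).aestronglyMeasurable ψ.continuous.aestronglyMeasurable)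
    rw [lintegral_mul_const' _ _ hW]
    exact ENNReal.mul_ne_top (ENNReal.add_ne_top.1 hsum.ne_top).2 hW

end Superposition

/-! ### Minkowski's inequality and products of superpositions. -/

section Minkowski

variable {α β : Type*} [MeasurableSpace α] [MeasurableSpace β] {μ : Measure α} {ν : Measure β}
  [SFinite μ] [SFinite ν]

/-- Minkowski's integral inequality in `L²`. -/
theorem lintegral_sq_lintegral_le {f : α → β → ℝ≥0∞} (hf : Measurable (Function.uncurry f)) :
    ∫⁻ z, (∫⁻ p, f z p ∂ν) ^ (2 : ℝ) ∂μ ≤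
      (∫⁻ p, (∫⁻ z, f z p ^ (2 : ℝ) ∂μ) ^ (1 / 2 : ℝ) ∂ν) ^ (2 : ℝ) := by
  obtain ⟨N, hN⟩ : ∃ N : β → ℝ≥0∞, N = fun p => (∫⁻ z, f z p ^ (2 : ℝ) ∂μ) ^ (1 / 2 : ℝ) :=
    ⟨_, rfl⟩
  obtain ⟨H, hH⟩ : ∃ H : α → ℝ≥0∞, H = fun z => ∫⁻ p, f z p ∂ν := ⟨_, rfl⟩
  have hHm : Measurable H := hH ▸ hf.lintegral_prod_right'
  have hfz : ∀ z, Measurable (f z) := fun z => hf.comp measurable_prodMk_left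
  have hfp : ∀ p, Measurable fun z => f z p := fun p => hf.comp measurable_prodMk_right
  have hNm : Measurable N := by
    rw [hN]
    exact ((hf.pow_const 2).lintegral_prod_left').pow_const _
  have hcs : ∀ p p', ∫⁻ z, f z p * f z p' ∂μ ≤ N p * N p' := fun p p' => by
    rw [hN]
    exact ENNReal.lintegral_mul_le_Lp_mul_Lq μ Real.HolderConjugate.two_two
      (hfp p).aemeasurable (hfp p').aemeasurable
  -- Expanding the second factor `H` and applying Cauchy–Schwarz to each pair `(p, p')` avoids
  -- dividing by the norm of `H`, so no finiteness is needed.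
  have hin : ∀ p, ∫⁻ z, f z p * H z ∂μ ≤ N p * ∫⁻ p', N p' ∂ν := fun p => by
    calc ∫⁻ z, f z p * H z ∂μ = ∫⁻ z, ∫⁻ p', f z p * f z p' ∂ν ∂μ := by
          refine lintegral_congr fun z => ?_
          rw [hH, lintegral_const_mul _ (hfz z)]
      _ = ∫⁻ p', ∫⁻ z, f z p * f z p' ∂μ ∂ν :=
          lintegral_lintegral_swap (((hfp p).comp measurable_fst).mul hf).aemeasurable
      _ ≤ ∫⁻ p', N p * N p' ∂ν := lintegral_mono fun p' => hcs p p'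
      _ = _ := lintegral_const_mul _ hNm
  calc ∫⁻ z, (∫⁻ p, f z p ∂ν) ^ (2 : ℝ) ∂μ = ∫⁻ z, ∫⁻ p, f z p * H z ∂ν ∂μ := by
        refine lintegral_congr fun z => ?_
        rw [lintegral_mul_const _ (hfz z), ENNReal.rpow_two, sq, hH]
    _ = ∫⁻ p, ∫⁻ z, f z p * H z ∂μ ∂ν :=
        lintegral_lintegral_swap (hf.mul (hHm.comp measurable_fst)).aemeasurable
    _ ≤ ∫⁻ p, N p * ∫⁻ p', N p' ∂ν ∂ν := lintegral_mono hin
    _ = _ := by rw [lintegral_mul_const _ hNm, ENNReal.rpow_two, sq, hN]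

theorem lintegral_sq_mul_lintegral_le {γ : Type*} [MeasurableSpace γ] {ρ : Measure γ} [SFinite ρ]
    {f : β × α → ℝ≥0∞} {g : γ × α → ℝ≥0∞} (hf : Measurable f) (hg : Measurable g) :
    ∫⁻ z, ((∫⁻ p, f (p, z) ∂ν) * ∫⁻ q, g (q, z) ∂ρ) ^ (2 : ℝ) ∂μ ≤
      (∫⁻ p, (∫⁻ z, (f (p.1, z) * g (p.2, z)) ^ (2 : ℝ) ∂μ) ^ (1 / 2 : ℝ) ∂(ν.prod ρ)) ^
        (2 : ℝ) := by
  have hprod : ∀ z, (∫⁻ p, f (p, z) ∂ν) * ∫⁻ q, g (q, z) ∂ρ =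
      ∫⁻ p, f (p.1, z) * g (p.2, z) ∂(ν.prod ρ) := fun z =>
    (lintegral_prod_mul (hf.comp measurable_prodMk_right).aemeasurable
      (hg.comp measurable_prodMk_right).aemeasurable).symm
  simp_rw [hprod]
  refine lintegral_sq_lintegral_le (f := fun z (p : β × γ) => f (p.1, z) * g (p.2, z)) ?_
  exact (hf.comp (by fun_prop : Measurable fun q : α × (β × γ) => (q.2.1, q.1))).mul
    (hg.comp (by fun_prop : Measurable fun q : α × (β × γ) => (q.2.2, q.1)))

end Minkowski

/-! ### Superposed free waves and mollification. -/

section Waves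

variable {d : ℕ}

theorem weightedL2_mul_le {s : ℝ} {m h : EuclideanSpace ℝ (Fin d) → ℂ} (hm : ∀ ξ, ‖m ξ‖ ≤ 1) :
    weightedL2 s (fun ξ => m ξ * h ξ) ≤ weightedL2 s h := by
  refine eLpNorm_mono fun ξ => ?_
  rw [norm_mul, norm_mul, norm_mul]
  exact mul_le_mul_of_nonneg_left (mul_le_of_le_one_left (norm_nonneg _) (hm ξ)) (norm_nonneg _)

theorem measurable_uncurry_freeWave {h : ℝ → EuclideanSpace ℝ (Fin d) → ℂ}
    (hh : Measurable (Function.uncurry h)) :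
    Measurable fun p : ℝ × (ℝ × EuclideanSpace ℝ (Fin d)) => freeWave (h p.1) p.2.1 p.2.2 := by
  unfold freeWave
  refine (StronglyMeasurable.integral_prod_right
    (f := fun (p : ℝ × (ℝ × EuclideanSpace ℝ (Fin d))) (ξ : EuclideanSpace ℝ (Fin d)) =>
    Complex.exp ((2 * Real.pi * inner ℝ p.2.2 ξ - 4 * Real.pi ^ 2 * p.2.1 * ‖ξ‖ ^ 2 : ℝ) *
      Complex.I) * h p.1 ξ) ?_).measurable
  refine Measurable.stronglyMeasurable (Measurable.mul (Continuous.measurable (by fun_prop)) ?_)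
  exact hh.comp (by fun_prop : Measurable fun
    q : (ℝ × (ℝ × EuclideanSpace ℝ (Fin d))) × EuclideanSpace ℝ (Fin d) => (q.1.1, q.2))

/-- Minkowski over the product measure reduces this to the bilinear estimate for each pair of free
waves, whose right-hand side factorises. -/
theorem exists_lintegral_superposition_mul_le (hd : 2 ≤ d) {s s' : ℝ} (hs : 2 * s < d - 1)
    (hs' : 2 * s' < d - 1) (hss : 2 * s + 2 * s' = d - 2) :
    ∃ C : ℝ≥0, ∀ (μ ν : Measure ℝ) [SFinite μ] [SFinite ν]
      (h k : ℝ → EuclideanSpace ℝ (Fin d) → ℂ),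
      Measurable (Function.uncurry h) → Measurable (Function.uncurry k) →
      (∀ᵐ r ∂μ, Integrable (h r) ∧ weightedL2 s (h r) ≠ ⊤) →
      (∀ᵐ r ∂ν, Integrable (k r) ∧ weightedL2 s' (k r) ≠ ⊤) →
      ∫⁻ z : ℝ × EuclideanSpace ℝ (Fin d), ((∫⁻ r, ‖freeWave (h r) z.1 z.2‖ₑ ∂μ) *
        ∫⁻ r, ‖freeWave (k r) z.1 z.2‖ₑ ∂ν) ^ (2 : ℝ) ≤
      (C * ((∫⁻ r, weightedL2 s (h r) ∂μ) * ∫⁻ r, weightedL2 s' (k r) ∂ν)) ^ (2 : ℝ) := by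
  obtain ⟨C, hC⟩ := exists_eLpNorm_freeWave_mul_le hd hs hs' hss
  refine ⟨C, fun μ ν _ _ h k hh hk hhi hki => ?_⟩
  have hhr : ∀ r, Measurable (h r) := fun r => hh.comp measurable_prodMk_left
  have hkr : ∀ r, Measurable (k r) := fun r => hk.comp measurable_prodMk_left
  have hmh := (measurable_uncurry_freeWave hh).enorm
  have hmk := (measurable_uncurry_freeWave hk).enorm
  refine (lintegral_sq_mul_lintegral_le hmh hmk).trans ?_
  refine ENNReal.rpow_le_rpow ?_ (by norm_num)
  have hwh := measurable_weightedL2 (s := s) hh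
  have hwk := measurable_weightedL2 (s := s') hk
  rw [← lintegral_prod_mul hwh.aemeasurable hwk.aemeasurable, ← lintegral_const_mul' _ _
    ENNReal.coe_ne_top]
  refine lintegral_mono_ae ?_
  filter_upwards [Measure.quasiMeasurePreserving_fst.ae hhi,
    Measure.quasiMeasurePreserving_snd.ae hki] with p hp hp'
  refine le_trans (le_of_eq ?_) (hC (h p.1) (k p.2) (hhr _) (hkr _) hp.1 hp'.1 hp.2 hp'.2)
  rw [eLpNorm_eq_lintegral_rpow_enorm_toReal (by norm_num) (by norm_num)]
  simp only [enorm_mul, ENNReal.toReal_ofNat]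

-- Normalised bumps are nonnegative of mass one, hence the bound on `𝓕 (χ n)`. Their outer radius is
-- always twice the inner one, so Lebesgue differentiation gives convergence almost everywhere.
open ContDiffBump in
theorem exists_seq_mollifier : ∃ χ : ℕ → 𝓢(EuclideanSpace ℝ (Fin d), ℂ),
    (∀ n, HasCompactSupport (χ n)) ∧ (∀ n ξ, ‖𝓕 (χ n) ξ‖ ≤ 1) ∧
    ∀ f : EuclideanSpace ℝ (Fin d) → ℂ, LocallyIntegrable f volume →
      ∀ᵐ x, Filter.Tendsto (fun n => ∫ z, f z * χ n (x - z)) Filter.atTop (nhds (f x)) := by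
  let b : ℕ → ContDiffBump (0 : EuclideanSpace ℝ (Fin d)) := fun n =>
    ⟨1 / ((n : ℝ) + 1), 2 * (1 / ((n : ℝ) + 1)), by positivity, by
      have : 0 < 1 / ((n : ℝ) + 1) := by positivity
      linarith⟩
  have hc : ∀ n, HasCompactSupport fun z => (((b n).normed volume z : ℝ) : ℂ) := fun n =>
    (b n).hasCompactSupport_normed.comp_left Complex.ofReal_zero
  let χ : ℕ → 𝓢(EuclideanSpace ℝ (Fin d), ℂ) := fun n => (hc n).toSchwartzMap
    (Complex.ofRealCLM.contDiff.comp (b n).contDiff_normed)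
  have hχ : ∀ n z, χ n z = (((b n).normed volume z : ℝ) : ℂ) := fun n z => rfl
  refine ⟨χ, hc, fun n ξ => ?_, fun f hf => ?_⟩
  · rw [SchwartzMap.fourier_coe, Real.fourier_eq]
    refine (norm_integral_le_integral_norm _).trans (le_of_eq ?_)
    simp only [Circle.norm_smul, hχ, Complex.norm_real, Real.norm_eq_abs,
      abs_of_nonneg ((b n).nonneg_normed _)]
    exact (b n).integral_normed
  · have hr : Filter.Tendsto (fun n => (b n).rOut) Filter.atTop (nhds 0) := by
      have h0 := tendsto_one_div_add_atTop_nhds_zero_nat (𝕜 := ℝ) |>.const_mul 2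
      rwa [mul_zero] at h0
    filter_upwards [ae_convolution_tendsto_right_of_locallyIntegrable (K := 2) hr
      (.of_forall fun n => le_rfl) hf] with x hx
    refine hx.congr fun n => ?_
    rw [convolution_lsmul_swap]
    refine integral_congr_ae (.of_forall fun z => ?_)
    simp only [hχ, Complex.real_smul, mul_comm]

theorem fourierInv_reflect_translate (χ : 𝓢(EuclideanSpace ℝ (Fin d), ℂ))
    (x ξ : EuclideanSpace ℝ (Fin d)) :
    𝓕⁻ (fun z => χ (x - z)) ξ = Complex.exp ((2 * Real.pi * inner ℝ x ξ : ℝ) * Complex.I) *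
      𝓕 χ ξ := by
  rw [SchwartzMap.fourier_coe, Real.fourierInv_eq', Real.fourier_eq', ← integral_const_mul,
    ← integral_sub_left_eq_self _ volume x]
  refine integral_congr_ae (.of_forall fun z => ?_)
  simp only [sub_sub_cancel, smul_eq_mul]
  rw [← mul_assoc, ← Complex.exp_add, inner_sub_left]
  congr 2
  push_cast
  ring

/-- If `u` is dominated on the Fourier side by a superposition of free waves, then so are its
mollifications. -/
theorem enorm_integral_mul_le_of_isGivenBy {f : 𝓢'(EuclideanSpace ℝ (Fin d), ℂ)}
    {g : EuclideanSpace ℝ (Fin d) → ℂ} (hg : IsGivenBy f g) {μ : Measure ℝ}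
    {h : ℝ → EuclideanSpace ℝ (Fin d) → ℂ} {t : ℝ}
    (hf : ∀ ψ : 𝓢(EuclideanSpace ℝ (Fin d), ℂ), ‖(𝓕 f) ψ‖ₑ ≤
        ∫⁻ r, ‖∫ ξ, freePropagator t ξ * h r ξ * ψ ξ‖ₑ ∂μ)
    {χ : 𝓢(EuclideanSpace ℝ (Fin d), ℂ)} (hχ : HasCompactSupport χ)
    (x : EuclideanSpace ℝ (Fin d)) :
    ‖∫ z, g z * χ (x - z)‖ₑ ≤ ∫⁻ r, ‖freeWave (fun ξ => 𝓕 χ ξ * h r ξ) t x‖ₑ ∂μ := by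
  obtain ⟨θ, hθ⟩ : ∃ θ : 𝓢(EuclideanSpace ℝ (Fin d), ℂ), ⇑θ = fun z => χ (x - z) := by
    refine ⟨(SchwartzMap.compCLMOfContinuousLinearEquiv ℂ
      (LinearIsometryEquiv.neg ℝ (E := EuclideanSpace ℝ (Fin d))) χ).compSubConstCLM ℂ x, ?_⟩
    ext z
    simp
  have hθc : HasCompactSupport θ := by
    rw [hθ]
    exact hχ.comp_homeomorph (Homeomorph.subLeft x)
  -- The test function on the frequency side is `𝓕⁻ θ`, which need not have compact support; this is
  -- why the domination is required for all Schwartz functions.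
  have h1 : (𝓕 f) (𝓕⁻ θ) = ∫ z, g z * χ (x - z) := by
    rw [TemperedDistribution.fourier_apply, FourierTransform.fourier_fourierInv_eq, hg.2 θ hθc, hθ]
  rw [← h1]
  refine (hf _).trans (le_of_eq (lintegral_congr fun r => ?_))
  rw [freeWave]
  congr 2
  ext ξ
  rw [SchwartzMap.fourierInv_coe, hθ, fourierInv_reflect_translate, freePropagator, mul_mul_mul_comm,
    mul_comm (h r ξ), ← mul_assoc, ← Complex.exp_add, mul_assoc]
  congr 2
  push_cast
  ring

end Waves

/-! ### Removal of the mollification and the final estimate. -/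

section Strichartz

variable {d : ℕ} {s s' : ℝ} {I : Set ℝ} {u v F G : ℝ → 𝓢'(EuclideanSpace ℝ (Fin d), ℂ)}
  {U V : ℝ → EuclideanSpace ℝ (Fin d) → ℂ} {t₀ : ℝ}

theorem IsGivenByOnSlab.eLpNorm_mul (hU : IsGivenByOnSlab I u U) (hV : IsGivenByOnSlab I v V) :
    eLpNorm (fun p : ℝ × EuclideanSpace ℝ (Fin d) => U p.1 p.2 * V p.1 p.2) 2
      ((volume.restrict I).prod volume) =
      (∫⁻ t in I, ∫⁻ x, ‖U t x * V t x‖ₑ ^ (2 : ℝ)) ^ (1 / 2 : ℝ) := by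
  have hm : AEMeasurable (fun p : ℝ × EuclideanSpace ℝ (Fin d) =>
      ‖U p.1 p.2 * V p.1 p.2‖ₑ ^ (2 : ℝ)) ((volume.restrict I).prod volume) :=
    (hU.1.mul hV.1).enorm.pow_const _
  rw [eLpNorm_eq_lintegral_rpow_enorm_toReal (by norm_num) (by norm_num), ENNReal.toReal_ofNat,
    lintegral_prod _ hm]

theorem eLpNorm_mul_eq_zero_of_ae_eq_zero (hU : IsGivenByOnSlab I u U)
    (hV : IsGivenByOnSlab I v V)
    (h : ∀ᵐ t ∂(volume.restrict I), ∀ᵐ x, U t x * V t x = 0) :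
    eLpNorm (fun p : ℝ × EuclideanSpace ℝ (Fin d) => U p.1 p.2 * V p.1 p.2) 2
      ((volume.restrict I).prod volume) = 0 := by
  rw [hU.eLpNorm_mul hV]
  have h0 : ∫⁻ t in I, ∫⁻ x, ‖U t x * V t x‖ₑ ^ (2 : ℝ) = 0 := by
    refine (lintegral_congr_ae (g := 0) ?_).trans lintegral_zero
    filter_upwards [h] with t ht
    refine (lintegral_congr_ae (g := 0) ?_).trans lintegral_zero
    filter_upwards [ht] with x hx
    simp [hx]
  refine (congrArg (fun a : ℝ≥0∞ => a ^ (1 / 2 : ℝ)) h0).trans (by norm_num)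

variable [NeZero d]

/-- Mollification multiplies the profiles by `𝓕 (χ n)`. As a Schwartz function this makes them
integrable, and being at most `1` in modulus it keeps the total norm below `M` uniformly in `n`. -/
theorem IsForcedSchrodinger.exists_dominating_freeWaves (hs : 2 * s < d) (hI : I.OrdConnected)
    (hu : IsForcedSchrodinger I u F) (hU : IsGivenByOnSlab I u U) (ht₀ : t₀ ∈ I) {M : ℝ≥0∞}
    (hM : homSobolevNorm s (u t₀) + timeL1HomSobolevNorm I s F < M)
    {χ : ℕ → 𝓢(EuclideanSpace ℝ (Fin d), ℂ)} (hχ : ∀ n, HasCompactSupport (χ n))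
    (hχ' : ∀ n ξ, ‖𝓕 (χ n) ξ‖ ≤ 1) :
    ∃ (μ : Measure ℝ) (h : ℕ → ℝ → EuclideanSpace ℝ (Fin d) → ℂ), SFinite μ ∧
      (∀ n, Measurable (Function.uncurry (h n))) ∧
      (∀ n, ∀ᵐ r ∂μ, Integrable (h n r) ∧ weightedL2 s (h n r) ≠ ⊤) ∧
      (∀ n, ∫⁻ r, weightedL2 s (h n r) ∂μ ≤ M) ∧
      ∀ᵐ t ∂(volume.restrict I), IsGivenBy (u t) (U t) ∧ ∀ n x,
        ‖∫ z, U t z * χ n (x - z)‖ₑ ≤ ∫⁻ r, ‖freeWave (h n r) t x‖ₑ ∂μ := by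
  obtain ⟨μ, h, hμ, hhm, hhM, hh⟩ := hu.exists_superposition hs hI ht₀ hM
  refine ⟨μ, fun n r ξ => 𝓕 (χ n) ξ * h r ξ, hμ, fun n => ?_, fun n => ?_, fun n => ?_, ?_⟩
  · exact ((𝓕 (χ n)).continuous.measurable.comp measurable_snd).mul hhm
  · filter_upwards [ae_lt_top (measurable_weightedL2 hhm) hhM.ne_top] with r hr
    have hhr : Measurable (h r) := hhm.comp measurable_prodMk_left
    refine ⟨⟨((𝓕 (χ n)).continuous.measurable.mul hhr).aestronglyMeasurable, ?_⟩,
      ((weightedL2_mul_le (hχ' n)).trans_lt hr).ne⟩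
    simp_rw [HasFiniteIntegral, mul_comm (𝓕 (χ n) _)]
    exact (lintegral_enorm_mul_le_weightedL2 (s := s) hhr.aestronglyMeasurable
      (𝓕 (χ n)).continuous.aestronglyMeasurable).trans_lt
      (ENNReal.mul_lt_top hr (weightedL2_neg_schwartz_ne_top hs _).lt_top)
  · exact (lintegral_mono fun r => weightedL2_mul_le (hχ' n)).trans hhM.le
  · filter_upwards [hU.2, ae_restrict_mem hI.measurableSet] with t ht htI
    exact ⟨ht, fun n x => enorm_integral_mul_le_of_isGivenBy ht (hh t htI) (hχ n) x⟩

/-- Serves the convention `0 · ∞ = 0`: if one factor on the right vanishes, so must the product on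
the left, even when the other factor is infinite. -/
theorem IsForcedSchrodinger.ae_eq_zero (hs : 2 * s < d) (hI : I.OrdConnected)
    (hu : IsForcedSchrodinger I u F) (hU : IsGivenByOnSlab I u U) (ht₀ : t₀ ∈ I)
    (h0 : homSobolevNorm s (u t₀) + timeL1HomSobolevNorm I s F = 0) :
    ∀ᵐ t ∂(volume.restrict I), U t =ᵐ[volume] 0 := by
  obtain ⟨χ, hχ, -, hlim⟩ := exists_seq_mollifier (d := d)
  filter_upwards [hU.2, ae_restrict_mem hI.measurableSet] with t ht htI
  have hz : ∀ ψ : 𝓢(EuclideanSpace ℝ (Fin d), ℂ), ‖(𝓕 (u t)) ψ‖ₑ = 0 := fun ψ => by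
    have hW := weightedL2_neg_schwartz_ne_top hs ψ
    -- Every positive `M` is admissible and the dual norm of `ψ` is finite, so the pairing vanishes
    -- as `M` decreases to `0`.
    have hle : ∀ M : ℝ≥0∞, 0 < M → ‖(𝓕 (u t)) ψ‖ₑ ≤ M * weightedL2 (-s) ψ := fun M hM => by
      obtain ⟨μ, h, hμ, hhm, hhM, hh⟩ := hu.exists_superposition hs hI ht₀ (h0.trans_lt hM)
      refine (hh t htI ψ).trans (le_trans ?_ (mul_le_mul' hhM.le le_rfl))
      rw [← lintegral_mul_const' _ _ hW]
      refine lintegral_mono fun r => (enorm_integral_le_lintegral_enorm _).trans ?_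
      refine le_trans (le_of_eq (lintegral_congr fun ξ => ?_))
        (lintegral_enorm_mul_le_weightedL2 (s := s)
          (hhm.comp measurable_prodMk_left : Measurable (h r)).aestronglyMeasurable
          ψ.continuous.aestronglyMeasurable)
      rw [enorm_mul, enorm_mul, enorm_mul, ← ofReal_norm (freePropagator t ξ),
        norm_freePropagator, ENNReal.ofReal_one, one_mul]
    have := ENNReal.le_mul_of_forall_lt (a := 0) (b := weightedL2 (-s) ψ)
      (c := ‖(𝓕 (u t)) ψ‖ₑ) (Or.inr hW) (Or.inl ENNReal.zero_ne_top)
      fun a' ha' b' hb' => (hle a' ha').trans (mul_le_mul' le_rfl hb'.le)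
    simpa using this
  filter_upwards [hlim (U t) ht.1] with x hx
  refine tendsto_nhds_unique hx (tendsto_const_nhds.congr fun n => ?_)
  have := enorm_integral_mul_le_of_isGivenBy (μ := 0) (t := t) (h := fun _ _ => 0) ht
    (fun ψ => (hz ψ).trans_le bot_le) (hχ n) x
  exact (enorm_eq_zero.1 (le_antisymm (by simpa using this) bot_le)).symm

/-- The mollified products converge almost everywhere on the slab and are dominated by products of
superposed free waves. Those are bounded in `L²` over all times uniformly in `n`, and Fatou's lemma
concludes. -/
theorem exists_eLpNorm_mul_le_of_lt (hd : 2 ≤ d) (hs : 2 * s < d - 1)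
    (hs' : 2 * s' < d - 1) (hss : 2 * s + 2 * s' = d - 2) :
    ∃ C : ℝ≥0, ∀ I : Set ℝ, I.OrdConnected → ∀ t₀ ∈ I,
      ∀ u v F G : ℝ → 𝓢'(EuclideanSpace ℝ (Fin d), ℂ),
      ∀ U V : ℝ → EuclideanSpace ℝ (Fin d) → ℂ,
        IsForcedSchrodinger I u F → IsForcedSchrodinger I v G →
        IsGivenByOnSlab I u U → IsGivenByOnSlab I v V →
        ∀ M M' : ℝ≥0∞, homSobolevNorm s (u t₀) + timeL1HomSobolevNorm I s F < M →
          homSobolevNorm s' (v t₀) + timeL1HomSobolevNorm I s' G < M' →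
          eLpNorm (fun p : ℝ × EuclideanSpace ℝ (Fin d) => U p.1 p.2 * V p.1 p.2) 2
            ((volume.restrict I).prod volume) ≤ C * (M * M') := by
  obtain ⟨C, hC⟩ := exists_lintegral_superposition_mul_le hd hs hs' hss
  refine ⟨C, fun I hI t₀ ht₀ u v F G U V hu hv hU hV M M' hM hM' => ?_⟩
  obtain ⟨χ, hχ, hχ1, hlim⟩ := exists_seq_mollifier (d := d)
  obtain ⟨μ, h, hμ, hhm, hhi, hhM, hhU⟩ :=
    hu.exists_dominating_freeWaves (s := s) (by linarith) hI hU ht₀ hM hχ hχ1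
  obtain ⟨ν, k, hν, hkm, hki, hkM, hkV⟩ :=
    hv.exists_dominating_freeWaves (s := s') (by linarith) hI hV ht₀ hM' hχ hχ1
  obtain ⟨A, hA⟩ : ∃ A : ℕ → ℝ × EuclideanSpace ℝ (Fin d) → ℝ≥0∞, A = fun n z =>
    ((∫⁻ r, ‖freeWave (h n r) z.1 z.2‖ₑ ∂μ) *
      ∫⁻ r, ‖freeWave (k n r) z.1 z.2‖ₑ ∂ν) ^ (2 : ℝ) := ⟨_, rfl⟩
  have hAm : ∀ n, Measurable (A n) := fun n => by
    rw [hA]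
    exact ((measurable_uncurry_freeWave (hhm n)).enorm.lintegral_prod_left'.mul
      (measurable_uncurry_freeWave (hkm n)).enorm.lintegral_prod_left').pow_const _
  have hAle : ∀ n, ∫⁻ z, A n z ≤ (C * (M * M')) ^ (2 : ℝ) := fun n => by
    rw [hA]
    refine (hC μ ν (h n) (k n) (hhm n) (hkm n) (hhi n) (hki n)).trans ?_
    exact ENNReal.rpow_le_rpow (mul_le_mul' le_rfl (mul_le_mul' (hhM n) (hkM n))) (by norm_num)
  have hLm : Measurable fun z => Filter.liminf (fun n => A n z) Filter.atTop :=
    Measurable.liminf hAm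
  have hpt : ∀ᵐ t ∂(volume.restrict I), ∀ᵐ x, ‖U t x * V t x‖ₑ ^ (2 : ℝ) ≤
      Filter.liminf (fun n => A n (t, x)) Filter.atTop := by
    filter_upwards [hhU, hkV] with t ht ht'
    filter_upwards [hlim (U t) ht.1.1, hlim (V t) ht'.1.1] with x hx hx'
    have h1 := ((ENNReal.continuous_rpow_const (y := 2)).tendsto _).comp (hx.mul hx').enorm
    rw [← h1.liminf_eq]
    refine Filter.liminf_le_liminf (.of_forall fun n => ?_)
    rw [hA]
    refine ENNReal.rpow_le_rpow ?_ (by norm_num)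
    refine (enorm_mul _ _).trans_le ?_
    exact mul_le_mul' (ht.2 n x) (ht'.2 n x)
  rw [hU.eLpNorm_mul hV, one_div, ENNReal.rpow_inv_le_iff (by norm_num)]
  calc ∫⁻ t in I, ∫⁻ x, ‖U t x * V t x‖ₑ ^ (2 : ℝ)
      ≤ ∫⁻ t in I, ∫⁻ x, Filter.liminf (fun n => A n (t, x)) Filter.atTop := by
        refine lintegral_mono_ae ?_
        filter_upwards [hpt] with t ht
        exact lintegral_mono_ae ht
    _ ≤ ∫⁻ t, ∫⁻ x, Filter.liminf (fun n => A n (t, x)) Filter.atTop :=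
        setLIntegral_le_lintegral _ _
    _ = ∫⁻ z, Filter.liminf (fun n => A n z) Filter.atTop := by
        rw [Measure.volume_eq_prod, lintegral_prod _ hLm.aemeasurable]
    _ ≤ Filter.liminf (fun n => ∫⁻ z, A n z) Filter.atTop := lintegral_liminf_le hAm
    _ ≤ Filter.liminf (fun _ : ℕ => (C * (M * M')) ^ (2 : ℝ)) Filter.atTop :=
        Filter.liminf_le_liminf (.of_forall hAle)
    _ = _ := Filter.liminf_const _

end Strichartz

theorem lemma3p3 (d : ℕ) (hd : 2 ≤ d) (δ : ℝ) (hδ : 0 < δ) (hδd : δ < (d : ℝ) / 2) :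
    ∃ C : ℝ≥0, ∀ I : Set ℝ, I.OrdConnected → ∀ t₀ ∈ I,
      ∀ u v F G : ℝ → 𝓢'(EuclideanSpace ℝ (Fin d), ℂ),
      ∀ U V : ℝ → EuclideanSpace ℝ (Fin d) → ℂ,
        IsForcedSchrodinger I u F → IsForcedSchrodinger I v G →
        IsGivenByOnSlab I u U → IsGivenByOnSlab I v V →
        eLpNorm (fun p : ℝ × EuclideanSpace ℝ (Fin d) => U p.1 p.2 * V p.1 p.2) 2
            ((volume.restrict I).prod volume) ≤
          C * (homSobolevNorm (-(1 / 2) + δ) (u t₀) +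
                timeL1HomSobolevNorm I (-(1 / 2) + δ) F) *
            (homSobolevNorm (((d : ℝ) - 1) / 2 - δ) (v t₀) +
              timeL1HomSobolevNorm I (((d : ℝ) - 1) / 2 - δ) G) := by
  have : NeZero d := ⟨by omega⟩
  obtain ⟨C, hC⟩ := exists_eLpNorm_mul_le_of_lt (d := d) (s := -(1 / 2) + δ)
    (s' := ((d : ℝ) - 1) / 2 - δ) hd (by linarith) (by linarith) (by ring)
  -- Adding `1` makes the constant nonzero, so that one may divide by it in `ℝ≥0∞`.
  refine ⟨C + 1, fun I hI t₀ ht₀ u v F G U V hu hv hU hV => ?_⟩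
  have hC0 : ((C + 1 : ℝ≥0) : ℝ≥0∞) ≠ 0 := by simp
  obtain ⟨N, hN⟩ : ∃ N, N = homSobolevNorm (-(1 / 2) + δ) (u t₀) +
    timeL1HomSobolevNorm I (-(1 / 2) + δ) F := ⟨_, rfl⟩
  obtain ⟨N', hN'⟩ : ∃ N', N' = homSobolevNorm (((d : ℝ) - 1) / 2 - δ) (v t₀) +
    timeL1HomSobolevNorm I (((d : ℝ) - 1) / 2 - δ) G := ⟨_, rfl⟩
  rw [← hN, ← hN']
  by_cases h0 : N = 0
  · refine (eLpNorm_mul_eq_zero_of_ae_eq_zero hU hV ?_).trans_le bot_le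
    filter_upwards [hu.ae_eq_zero (by linarith) hI hU ht₀ (hN ▸ h0)] with t ht
    filter_upwards [ht] with x hx
    simp [hx]
  by_cases h0' : N' = 0
  · refine (eLpNorm_mul_eq_zero_of_ae_eq_zero hU hV ?_).trans_le bot_le
    filter_upwards [hv.ae_eq_zero (by linarith) hI hV ht₀ (hN' ▸ h0')] with t ht
    filter_upwards [ht] with x hx
    simp [hx]
  rw [mul_assoc, mul_comm, ← ENNReal.div_le_iff hC0 ENNReal.coe_ne_top]
  -- Infimum over all `M > N` and `M' > N'`; it equals `N * N'` here because neither factor is zero,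
  -- which excludes `0 · ∞`.
  refine ENNReal.le_mul_of_forall_lt (Or.inl h0) (Or.inr h0') fun M hM M' hM' => ?_
  rw [ENNReal.div_le_iff hC0 ENNReal.coe_ne_top, mul_comm]
  refine (hC I hI t₀ ht₀ u v F G U V hu hv hU hV M M' (hN ▸ hM) (hN' ▸ hM')).trans ?_
  exact mul_le_mul' (by simp) le_rfl
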